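/- Let $a$ be an integer and let $f$ be a real-valued function on the natural numbers such that $f(N)\to\infty$ as $N\to\infty$. Let $\sigma(N)$ denote the sum of the positive divisors of $N$, and let $(m,n)$ denote the greatest common divisor of $m$ and $n$. Then there is a set $E$ of primes, depending on $f$ and $a$, which has relative density zero among the primes, i.e. $$\lim_{x\to\infty}\frac{\#\{p\le x : p\in E\}}{\pi(x)}=0,$$ where $\pi(x)$ is the number of primes not exceeding $x$, such that every prime $p\notin E$ satisfies $p+a\ge 3$ and $$(p+a,\ \sigma(p+a))\le(\log\log(p+a))^{f(p+a)}.$$ -/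

import Mathlib

/-- A set `E` of natural numbers has relative density zero among the primes:
`#{p ≤ x : p prime, p ∈ E} / π(x) → 0` as `x → ∞`. -/
def HasPrimeDensityZero (E : Set ℕ) : Prop :=
  Filter.Tendsto
    (fun x : ℕ => (Set.ncard {p : ℕ | p ≤ x ∧ p.Prime ∧ p ∈ E} : ℝ) / (Nat.primeCounting x : ℝ))
    Filter.atTop (nhds 0)

/-! Put N = p + a with p ≤ x. A prime l dividing both N and σ(N) divides σ(q^k) for some prime power
q^k exactly dividing N. If k = 1, then q ≡ -1 (mod l) and lq divides N. If k ≥ 2, then l < 2q^k, and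
q^k is small unless N is divisible by the square of a large prime power. Take w close to log log x
and z = 2w^3. If N has no divisor m^2 with m > w a prime power, and no divisor lq with l > z and q ≡
-1 (mod l), then every prime power dividing gcd(N, σ(N)) is at most z, so log gcd(N, σ(N)) is at
most the sum of Λ(d) over d ≤ z dividing N (`log_gcd_sigma_le`). A Brun–Titchmarsh bound and
Mertens' estimate bound the mean of this sum over p by O(log z), so by Markov's inequality it is at
most K log log log x for all but a proportion ε of the primes, with K depending on ε. As f tends to
infinity, it eventually exceeds any such K.

It remains to see that the excluded p are rare. Square divisors contribute a sum of 1/m^2 over m >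
w. Pairs (l, q) fall into three ranges. For l > L, with L about (log x)^3, counting integers is
enough (`card_largePrimes_exists_very_large_le`). For l ≤ L and q ≤ Q, with Q about x^(1/4),
Brun–Titchmarsh modulo lq is combined with a bound O((log l + log log x)/l) for the sum of 1/q over
primes q ≡ -1 (mod l) (`card_largePrimes_exists_small_le`). For q > Q, write N = lqm and q = lj - 1.
For fixed l and m, the numbers lj - 1 and lm(lj - 1) - a must both be prime. A two-dimensional sieve
saves (log x)^2, of which the sum over m costs only one logarithm
(`exists_card_largePrimes_exists_large_le`). The only sieve needed is Selberg's upper bound sieve,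
in dimensions one and two. -/

/-! ### Selberg's upper bound sieve. -/

open Finset ArithmeticFunction in
-- Möbius inversion over multiples, which diagonalises Selberg's quadratic form: for d = lc dividing
-- a squarefree e, μ(d) = μ(l)μ(c), and the sum of μ(c) over c dividing e/l vanishes unless e = l.
theorem sum_moebius_filter_dvd {l e : ℕ} (he : Squarefree e) :
    ∑ d ∈ e.divisors with l ∣ d, (moebius d : ℝ) = if l = e then (moebius l : ℝ) else 0 := by
  by_cases hle : l ∣ e
  · obtain ⟨k, rfl⟩ := hle
    have h0 : l * k ≠ 0 := he.ne_zero
    have hl0 : l ≠ 0 := left_ne_zero_of_mul h0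
    have hk0 : k ≠ 0 := right_ne_zero_of_mul h0
    have hco : l.Coprime k := Nat.coprime_of_squarefree_mul he
    have h1 : ∑ d ∈ (l * k).divisors with l ∣ d, (moebius d : ℝ) =
        ∑ d ∈ k.divisors, (moebius (l * d) : ℝ) := by
      refine (sum_bij (fun d _ ↦ l * d) ?_ ?_ ?_ ?_).symm
      · intro d hd
        simp only [mem_filter, Nat.mem_divisors] at hd ⊢
        exact ⟨⟨mul_dvd_mul_left _ hd.1, h0⟩, dvd_mul_right _ _⟩
      · intro d _ d' _ h
        exact Nat.eq_of_mul_eq_mul_left (Nat.pos_of_ne_zero hl0) h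
      · intro d hd
        simp only [mem_filter, Nat.mem_divisors] at hd
        obtain ⟨c, rfl⟩ := hd.2
        exact ⟨c, by simp [hk0, Nat.dvd_of_mul_dvd_mul_left (Nat.pos_of_ne_zero hl0) hd.1.1], rfl⟩
      · intros; rfl
    have h2 : ∀ d ∈ k.divisors, (moebius (l * d) : ℝ) = moebius l * moebius d := by
      intro d hd
      rw [isMultiplicative_moebius.map_mul_of_coprime
        (hco.coprime_dvd_right (Nat.dvd_of_mem_divisors hd))]
      push_cast; rfl
    rw [h1, sum_congr rfl h2, ← mul_sum]
    have h3 : ∑ d ∈ k.divisors, (moebius d : ℝ) = if k = 1 then 1 else 0 := by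
      have := congrArg (fun f : ArithmeticFunction ℤ ↦ f k) moebius_mul_coe_zeta
      simp only [coe_mul_zeta_apply, one_apply] at this
      exact_mod_cast this
    rw [h3]
    by_cases hk : k = 1
    · simp [hk]
    · have : l ≠ l * k := by
        intro h
        exact hk (Nat.eq_of_mul_eq_mul_left (Nat.pos_of_ne_zero hl0) (by omega))
      simp [hk, this]
  · rw [if_neg (by rintro rfl; exact hle dvd_rfl), sum_eq_zero]
    intro d hd
    simp only [mem_filter, Nat.mem_divisors] at hd
    exact absurd (hd.2.trans hd.1.1) hle

namespace BoundingSieve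
open Finset ArithmeticFunction

variable (s : BoundingSieve)

/-- The sum of the Selberg terms up to level `R`. -/
noncomputable def selbergSum (R : ℕ) : ℝ :=
  ∑ e ∈ s.prodPrimes.divisors with e ≤ R, s.selbergTerms e

/-- The optimal Selberg weights of level `R`. -/
noncomputable def selbergWeight (R d : ℕ) : ℝ :=
  (s.nu d)⁻¹ * moebius d *
    ((∑ e ∈ s.prodPrimes.divisors with e ≤ R ∧ d ∣ e, s.selbergTerms e) / s.selbergSum R)

variable {s}

theorem selbergSum_pos {R : ℕ} (hR : 1 ≤ R) : 0 < s.selbergSum R := by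
  refine sum_pos (fun e he ↦ ?_) ⟨1, ?_⟩
  · exact selbergTerms_pos (Nat.dvd_of_mem_divisors (mem_filter.1 he).1)
  · simp [hR, prodPrimes_ne_zero]

theorem selbergWeight_one {R : ℕ} (hR : 1 ≤ R) : s.selbergWeight R 1 = 1 := by
  have h : s.nu 1 = 1 := s.nu_mult.map_one
  have h2 : ∑ e ∈ s.prodPrimes.divisors with e ≤ R ∧ 1 ∣ e, s.selbergTerms e = s.selbergSum R := by
    simp [selbergSum]
  rw [selbergWeight, h2, div_self (selbergSum_pos hR).ne']
  simp [h]

theorem selbergWeight_eq_zero {R d : ℕ} (hd : R < d) : s.selbergWeight R d = 0 := by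
  have : ∑ e ∈ s.prodPrimes.divisors with e ≤ R ∧ d ∣ e, s.selbergTerms e = 0 := by
    refine sum_eq_zero fun e he ↦ ?_
    simp only [mem_filter, Nat.mem_divisors] at he
    have := Nat.le_of_dvd (Nat.pos_of_ne_zero (ne_zero_of_dvd_ne_zero he.1.2 he.1.1)) he.2.2
    omega
  rw [selbergWeight, this]; simp

/-- The quotient in the weight compares a subsum of positive terms with the whole. This is cruder
than the classical bound by 1, but the sieve level is later taken to be a tiny power of x. -/
theorem abs_selbergWeight_le {R d : ℕ} (hR : 1 ≤ R) (hd : d ∣ s.prodPrimes) :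
    |s.selbergWeight R d| ≤ (s.nu d)⁻¹ := by
  have h0 : 0 < (s.nu d)⁻¹ := inv_pos.2 (nu_pos_of_dvd_prodPrimes hd)
  have hm : |(moebius d : ℝ)| ≤ 1 := by exact_mod_cast abs_moebius_le_one
  have hS := selbergSum_pos (s := s) hR
  have hpos : ∀ e ∈ s.prodPrimes.divisors, 0 ≤ s.selbergTerms e := fun e he ↦
    (selbergTerms_pos (Nat.dvd_of_mem_divisors he)).le
  have hq : |(∑ e ∈ s.prodPrimes.divisors with e ≤ R ∧ d ∣ e, s.selbergTerms e) /
      s.selbergSum R| ≤ 1 := by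
    rw [abs_of_nonneg (div_nonneg (sum_nonneg fun e he ↦ hpos e (mem_filter.1 he).1) hS.le),
      div_le_one hS]
    refine sum_le_sum_of_subset_of_nonneg ?_ fun e he _ ↦ hpos e (mem_filter.1 he).1
    intro e; simp +contextual
  rw [selbergWeight, abs_mul, abs_mul, abs_of_pos h0]
  calc (s.nu d)⁻¹ * |(moebius d : ℝ)| * _ ≤ (s.nu d)⁻¹ * 1 * 1 := by gcongr
    _ = _ := by ring

/-- These sums are the coordinates in which the main term is diagonal. After exchanging d and e, the
Möbius sum leaves only e = l, so the weights realise the minimising point. -/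
theorem sum_nu_mul_selbergWeight {R l : ℕ} (hl : l ∣ s.prodPrimes) :
    ∑ d ∈ s.prodPrimes.divisors, (if l ∣ d then s.nu d * s.selbergWeight R d else 0) =
      if l ≤ R then moebius l * s.selbergTerms l / s.selbergSum R else 0 := by
  have hP := prodPrimes_ne_zero (s := s)
  have h1 : ∀ d ∈ s.prodPrimes.divisors, (if l ∣ d then s.nu d * s.selbergWeight R d else 0) =
      ∑ e ∈ s.prodPrimes.divisors with e ≤ R, if l ∣ d ∧ d ∣ e then
        (moebius d : ℝ) * (s.selbergTerms e / s.selbergSum R) else 0 := by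
    intro d hd
    have hnu := nu_ne_zero (Nat.dvd_of_mem_divisors hd)
    by_cases h : l ∣ d
    · simp only [h, true_and, if_true]
      rw [selbergWeight, ← sum_filter, filter_filter, ← mul_sum, sum_div]
      field_simp
    · simp [h]
  rw [sum_congr rfl h1, sum_comm]
  have h2 : ∀ e ∈ s.prodPrimes.divisors.filter (· ≤ R),
      (∑ d ∈ s.prodPrimes.divisors, if l ∣ d ∧ d ∣ e then
        (moebius d : ℝ) * (s.selbergTerms e / s.selbergSum R) else 0) =
      if l = e then (moebius l : ℝ) * (s.selbergTerms e / s.selbergSum R) else 0 := by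
    intro e he
    have heP := Nat.dvd_of_mem_divisors (mem_filter.1 he).1
    have := sum_moebius_filter_dvd (l := l) (squarefree_of_dvd_prodPrimes heP)
    rw [← sum_filter, ← sum_mul]
    have h3 : s.prodPrimes.divisors.filter (fun d ↦ l ∣ d ∧ d ∣ e) =
        e.divisors.filter (fun d ↦ l ∣ d) := by
      rw [← Nat.divisors_filter_dvd_of_dvd hP heP, filter_filter]
      ext d; simp only [mem_filter]; tauto
    rw [h3, this]; split_ifs <;> simp
  rw [sum_congr rfl h2, sum_ite_eq]
  simp [hl, hP, mul_div_assoc]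

theorem mainSum_selbergWeight {R : ℕ} (hR : 1 ≤ R) :
    s.mainSum (lambdaSquared (s.selbergWeight R)) = (s.selbergSum R)⁻¹ := by
  rw [mainSum_lambdaSquared_eq_sum_mul_sum_sq]
  have h1 : ∀ l ∈ s.prodPrimes.divisors, (s.selbergTerms l)⁻¹ *
      (∑ d ∈ s.prodPrimes.divisors, if l ∣ d then s.nu d * s.selbergWeight R d else 0) ^ 2 =
      if l ≤ R then s.selbergTerms l / s.selbergSum R ^ 2 else 0 := by
    intro l hl
    have hlP := Nat.dvd_of_mem_divisors hl
    rw [sum_nu_mul_selbergWeight hlP]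
    split_ifs
    · have hm : (moebius l : ℝ) ^ 2 = 1 := by
        exact_mod_cast moebius_sq_eq_one_of_squarefree (squarefree_of_dvd_prodPrimes hlP)
      have := (selbergTerms_pos hlP).ne'
      rw [div_pow, mul_pow, hm]
      field_simp
    · simp
  have hS := selbergSum_pos (s := s) hR
  rw [sum_congr rfl h1, ← sum_filter, ← sum_div, ← selbergSum]
  field_simp

/-- There are at most R^2 pairs of divisors up to R, each weight is at most R, and the remainder at
their least common multiple is at most R^2. -/
theorem errSum_selbergWeight_le {R : ℕ} (hR : 1 ≤ R)
    (hnu : ∀ d, d ∣ s.prodPrimes → (s.nu d)⁻¹ ≤ d) (hrem : ∀ d, d ∣ s.prodPrimes → |s.rem d| ≤ d) :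
    s.errSum (lambdaSquared (s.selbergWeight R)) ≤ (R : ℝ) ^ 6 := by
  set w := s.selbergWeight R with hw
  set D := s.prodPrimes.divisors.filter (· ≤ R) with hD
  have hP := prodPrimes_ne_zero (s := s)
  have h1 : ∀ d ∈ s.prodPrimes.divisors, |lambdaSquared w d| * |s.rem d| ≤
      ∑ d1 ∈ D, ∑ d2 ∈ D, if d = d1.lcm d2 then |w d1| * |w d2| * d else 0 := by
    intro d hd
    have hdP := Nat.dvd_of_mem_divisors hd
    have h2 : |lambdaSquared w d| ≤
        ∑ d1 ∈ D, ∑ d2 ∈ D, if d = d1.lcm d2 then |w d1| * |w d2| else 0 := by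
      rw [lambdaSquared]
      have hsub : ∀ g : ℕ → ℝ, (∀ k, R < k → g k = 0) → (∀ k, 0 ≤ g k) →
          ∑ k ∈ d.divisors, g k ≤ ∑ k ∈ D, g k := by
        intro g hg hg0
        rw [← sum_filter_add_sum_filter_not d.divisors (· ≤ R)]
        rw [sum_eq_zero (s := d.divisors.filter (fun k ↦ ¬ k ≤ R)), add_zero]
        · refine sum_le_sum_of_subset_of_nonneg ?_ fun k _ _ ↦ hg0 k
          intro k hk
          simp only [hD, mem_filter, Nat.mem_divisors] at hk ⊢
          exact ⟨⟨hk.1.1.trans hdP, hP⟩, hk.2⟩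
        · intro k hk
          exact hg k (not_le.1 (mem_filter.1 hk).2)
      calc _ ≤ ∑ d1 ∈ d.divisors, ∑ d2 ∈ d.divisors,
            |if d = d1.lcm d2 then w d1 * w d2 else 0| :=
            (abs_sum_le_sum_abs _ _).trans (sum_le_sum fun _ _ ↦ abs_sum_le_sum_abs _ _)
        _ = ∑ d1 ∈ d.divisors, ∑ d2 ∈ d.divisors,
            if d = d1.lcm d2 then |w d1| * |w d2| else 0 := by
            congr! 2; split_ifs <;> simp [abs_mul]
        _ ≤ ∑ d1 ∈ d.divisors, ∑ d2 ∈ D, if d = d1.lcm d2 then |w d1| * |w d2| else 0 := by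
            refine sum_le_sum fun d1 _ ↦ hsub _ ?_ ?_
            · intro k hk; simp [hw, selbergWeight_eq_zero hk]
            · intro k; positivity
        _ ≤ _ := by
            refine hsub _ ?_ ?_
            · intro k hk; simp [hw, selbergWeight_eq_zero hk]
            · intro k; positivity
    calc _ ≤ (∑ d1 ∈ D, ∑ d2 ∈ D, if d = d1.lcm d2 then |w d1| * |w d2| else 0) * d := by
          gcongr
          · exact hrem d hdP
      _ = _ := by simp_rw [sum_mul, ite_mul, zero_mul]
  rw [errSum]
  calc _ ≤ ∑ d ∈ s.prodPrimes.divisors,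
        ∑ d1 ∈ D, ∑ d2 ∈ D, (if d = d1.lcm d2 then |w d1| * |w d2| * d else 0) := sum_le_sum h1
    _ = ∑ d1 ∈ D, ∑ d2 ∈ D, ∑ d ∈ s.prodPrimes.divisors,
        (if d = d1.lcm d2 then |w d1| * |w d2| * d else 0) := by
        rw [sum_comm]; exact sum_congr rfl fun _ _ ↦ sum_comm
    _ ≤ ∑ d1 ∈ D, ∑ d2 ∈ D, (R : ℝ) ^ 4 := by
        refine sum_le_sum fun d1 hd1 ↦ sum_le_sum fun d2 hd2 ↦ ?_
        simp only [hD, mem_filter, Nat.mem_divisors] at hd1 hd2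
        have hl : d1.lcm d2 ∈ s.prodPrimes.divisors := by
          simp [hP, Nat.lcm_dvd hd1.1.1 hd2.1.1]
        rw [sum_ite_eq_of_mem' _ _ _ hl]
        have b1 : |w d1| ≤ R := ((abs_selbergWeight_le hR hd1.1.1).trans (hnu _ hd1.1.1)).trans
          (by exact_mod_cast hd1.2)
        have b2 : |w d2| ≤ R := ((abs_selbergWeight_le hR hd2.1.1).trans (hnu _ hd2.1.1)).trans
          (by exact_mod_cast hd2.2)
        have b3 : ((d1.lcm d2 : ℕ) : ℝ) ≤ R * R := by
          have := Nat.le_of_dvd (Nat.mul_pos (Nat.pos_of_ne_zero (ne_zero_of_dvd_ne_zero hP hd1.1.1))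
            (Nat.pos_of_ne_zero (ne_zero_of_dvd_ne_zero hP hd2.1.1))) (Nat.lcm_dvd_mul d1 d2)
          exact_mod_cast this.trans (Nat.mul_le_mul hd1.2 hd2.2)
        calc _ ≤ (R : ℝ) * R * (R * R) := by gcongr
          _ = _ := by ring
    _ = (#D : ℝ) * #D * (R : ℝ) ^ 4 := by simp; ring
    _ ≤ (R : ℝ) * R * (R : ℝ) ^ 4 := by
        have : #D ≤ R := by
          have : D ⊆ Icc 1 R := by
            intro d hd
            simp only [hD, mem_filter, Nat.mem_divisors, mem_Icc] at hd ⊢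
            exact ⟨Nat.pos_of_ne_zero (ne_zero_of_dvd_ne_zero hP hd.1.1), hd.2⟩
          simpa using card_le_card this
        gcongr
    _ = _ := by ring

/-- `selbergTerms d` is ν(d) times factors 1/(1 - ν(p)) ≥ 1. Dropping these leaves a denominator in
ν alone, which is easier to bound below. -/
theorem siftedSum_le_selberg {R : ℕ} (hR : 1 ≤ R) (hX : 0 ≤ s.totalMass)
    (hnu : ∀ d, d ∣ s.prodPrimes → (s.nu d)⁻¹ ≤ d) (hrem : ∀ d, d ∣ s.prodPrimes → |s.rem d| ≤ d) :
    siftedSum (s := s) ≤ s.totalMass / (∑ d ∈ s.prodPrimes.divisors with d ≤ R, s.nu d) + (R : ℝ) ^ 6 := by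
  have h := siftedSum_le_mainSum_errSum_of_upperMoebius (s := s) _
    (upperMoebius_lambdaSquared (s.selbergWeight R) (selbergWeight_one hR))
  rw [mainSum_selbergWeight hR, ← div_eq_mul_inv] at h
  refine h.trans (add_le_add ?_ (errSum_selbergWeight_le hR hnu hrem))
  have hpos : 0 < ∑ d ∈ s.prodPrimes.divisors with d ≤ R, s.nu d := by
    refine sum_pos (fun e he ↦ ?_) ⟨1, ?_⟩
    · exact nu_pos_of_dvd_prodPrimes (Nat.dvd_of_mem_divisors (mem_filter.1 he).1)
    · simp [hR, prodPrimes_ne_zero]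
  refine div_le_div_of_nonneg_left hX hpos (sum_le_sum fun d hd ↦ ?_)
  have hdP := Nat.dvd_of_mem_divisors (mem_filter.1 hd).1
  rw [selbergTerms_apply]
  refine le_mul_of_one_le_right (nu_pos_of_dvd_prodPrimes hdP).le ?_
  calc (1 : ℝ) = ∏ p ∈ d.primeFactors, 1 := by simp
    _ ≤ _ := prod_le_prod (fun _ _ ↦ zero_le_one) fun p hp ↦ ?_
  have hp_prime : p.Prime := Nat.prime_of_mem_primeFactors hp
  have hp_dvd : p ∣ s.prodPrimes := (Nat.dvd_of_mem_primeFactors hp).trans hdP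
  have h1 := s.nu_lt_one_of_prime p hp_prime hp_dvd
  have h2 := s.nu_pos_of_prime p hp_prime hp_dvd
  exact (one_le_inv₀ (by linarith)).2 (by linarith)

end BoundingSieve

open Finset ArithmeticFunction in
open scoped Classical in
/-- **Selberg's upper bound sieve** for the values of an integer sequence. -/
theorem card_filter_not_dvd_le_selberg (n : ℕ) (F : ℕ → ℤ) {P : ℕ} (hP : Squarefree P)
    (ν : ArithmeticFunction ℝ) (hν : ν.IsMultiplicative)
    (hν0 : ∀ p : ℕ, p.Prime → p ∣ P → 0 < ν p) (hν1 : ∀ p : ℕ, p.Prime → p ∣ P → ν p < 1)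
    {R : ℕ} (hR : 1 ≤ R) (hνd : ∀ d, d ∣ P → (ν d)⁻¹ ≤ d)
    (hrem : ∀ d : ℕ, d ∣ P → |(#{j ∈ Icc 1 n | (d : ℤ) ∣ F j} : ℝ) - ν d * n| ≤ d) :
    (#{j ∈ Icc 1 n | ∀ p : ℕ, p.Prime → p ∣ P → ¬ (p : ℤ) ∣ F j} : ℝ) ≤
      n / (∑ d ∈ P.divisors with d ≤ R, ν d) + (R : ℝ) ^ 6 := by
  let s : BoundingSieve :=
    -- The sieve acts on weighted natural numbers, so the sequence is recorded by its absolute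
    -- values, each weighted by its multiplicity.
    { support := (Icc 1 n).image fun j ↦ (F j).natAbs
      prodPrimes := P
      prodPrimes_squarefree := hP
      weights := fun k ↦ #{j ∈ Icc 1 n | (F j).natAbs = k}
      weights_nonneg := fun k ↦ by positivity
      totalMass := n
      nu := ν
      nu_mult := hν
      nu_pos_of_prime := hν0
      nu_lt_one_of_prime := hν1 }
  have key : ∀ q : ℕ → Prop, [DecidablePred q] →
      (∑ k ∈ s.support, if q k then s.weights k else 0) = #{j ∈ Icc 1 n | q (F j).natAbs} := by
    intro q _
    have h1 : (#{j ∈ Icc 1 n | q (F j).natAbs} : ℝ) =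
        ∑ j ∈ Icc 1 n, if q (F j).natAbs then (1 : ℝ) else 0 := by simp
    rw [h1, ← sum_fiberwise_of_maps_to (g := fun j ↦ (F j).natAbs) (t := s.support)
      (fun j hj ↦ mem_image_of_mem _ hj)]
    refine sum_congr rfl fun k _ ↦ ?_
    have h2 : ∀ j ∈ (Icc 1 n).filter (fun j ↦ (F j).natAbs = k),
        (if q (F j).natAbs then (1 : ℝ) else 0) = if q k then 1 else 0 := by
      intro j hj; rw [(mem_filter.1 hj).2]
    rw [sum_congr rfl h2]
    simp [s]
  have hs := BoundingSieve.siftedSum_le_selberg (s := s) hR (by positivity : (0 : ℝ) ≤ n) hνd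
    (fun d hd ↦ by
      have := hrem d hd
      rw [BoundingSieve.rem, BoundingSieve.multSum, key]
      simpa [Int.natCast_dvd] using this)
  refine le_trans (le_of_eq ?_) hs
  rw [BoundingSieve.siftedSum, key]
  congr 2
  refine filter_congr fun j _ ↦ ?_
  constructor
  · intro h
    refine Nat.coprime_of_dvd fun p hp h1 h2 ↦ h p hp h1 (Int.natCast_dvd.2 h2)
  · intro h p hp h1 h2
    exact Nat.not_coprime_of_dvd_of_dvd hp.one_lt h1 (Int.natCast_dvd.1 h2) h

/-! ### Elementary sums over divisors, squarefree numbers and prime powers. -/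

/-- The sum of the reciprocals of the divisors of `n`. -/
noncomputable def sumInvDivisors (n : ℕ) : ℝ := ∑ d ∈ n.divisors, (d : ℝ)⁻¹

/-- The sum of `1 / d` over the squarefree `d ≤ R` that are coprime to `B`. -/
noncomputable def sumInvSquarefreeCoprime (B R : ℕ) : ℝ :=
  ∑ d ∈ Finset.Icc 1 R with Squarefree d ∧ d.Coprime B, (d : ℝ)⁻¹

section
open Finset

theorem sumInvDivisors_nonneg (n : ℕ) : 0 ≤ sumInvDivisors n := sum_nonneg fun _ _ ↦ by positivity

theorem one_le_sumInvDivisors {n : ℕ} (hn : n ≠ 0) : 1 ≤ sumInvDivisors n := by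
  have := single_le_sum (f := fun d : ℕ ↦ (d : ℝ)⁻¹) (fun _ _ ↦ by positivity)
    (Nat.one_mem_divisors.2 hn)
  simpa [sumInvDivisors] using this

/-- The quantity σ(n)/n takes the place of n/φ(n) as the cost of not sieving by the primes dividing
n. Coprimality is not needed, as every divisor of mn is a product of a divisor of m and a divisor of
n. -/
theorem sumInvDivisors_mul_le (m n : ℕ) :
    sumInvDivisors (m * n) ≤ sumInvDivisors m * sumInvDivisors n := by
  classical
  rw [sumInvDivisors, sumInvDivisors, sumInvDivisors, sum_mul_sum, ← sum_product',
    Nat.divisors_mul, mul_def]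
  refine (sum_image_le_of_nonneg fun _ _ ↦ by positivity).trans (le_of_eq ?_)
  refine sum_congr rfl fun x _ ↦ ?_
  push_cast
  exact mul_inv _ _

theorem sumInvDivisors_prime_pow_le {p k : ℕ} (hp : p.Prime) : sumInvDivisors (p ^ k) ≤ 2 := by
  have h2 : (2 : ℝ) ≤ p := by exact_mod_cast hp.two_le
  have : ∀ k : ℕ, ∑ i ∈ range (k + 1), (((p ^ i : ℕ) : ℝ))⁻¹ ≤ 2 - (2 ^ k : ℝ)⁻¹ := by
    intro k
    induction k with
    | zero => norm_num
    | succ k ih =>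
      rw [sum_range_succ]
      have h3 : (((p ^ (k + 1) : ℕ) : ℝ))⁻¹ ≤ (2 ^ (k + 1) : ℝ)⁻¹ := by
        push_cast
        gcongr
      have h4 : (2 ^ k : ℝ)⁻¹ = 2 * (2 ^ (k + 1) : ℝ)⁻¹ := by
        rw [pow_succ]; field_simp
      linarith
  rw [sumInvDivisors, Nat.sum_divisors_prime_pow hp]
  have := this k
  have h5 : (0 : ℝ) ≤ (2 ^ k : ℝ)⁻¹ := by positivity
  linarith

theorem sum_Ioc_inv_sq_le (w M : ℕ) (hw : 1 ≤ w) :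
    ∑ m ∈ Ioc w M, ((m : ℝ) ^ 2)⁻¹ ≤ (w : ℝ)⁻¹ := by
  rcases le_total w M with h | h
  · have := sum_Ioc_inv_sq_le_sub (α := ℝ) (by omega : w ≠ 0) h
    have h2 : (0 : ℝ) ≤ (M : ℝ)⁻¹ := by positivity
    linarith
  · simp [Ioc_eq_empty_of_le h]

theorem sum_Icc_inv_sq_le (M : ℕ) : ∑ m ∈ Icc 1 M, ((m : ℝ) ^ 2)⁻¹ ≤ 2 := by
  rcases Nat.eq_zero_or_pos M with rfl | h
  · simp
  · have h1 : Icc 1 M = insert 1 (Ioc 1 M) := by ext; simp; omega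
    have := sum_Ioc_inv_sq_le 1 M le_rfl
    rw [h1, sum_insert (by simp)]
    norm_num at this ⊢
    linarith

theorem sum_Icc_inv_le (M : ℕ) : ∑ m ∈ Icc 1 M, (m : ℝ)⁻¹ ≤ 1 + Real.log M := by
  have := harmonic_le_one_add_log M
  rw [harmonic_eq_sum_Icc] at this
  simpa using this

theorem log_le_sum_Icc_inv (M : ℕ) : Real.log M ≤ ∑ m ∈ Icc 1 M, (m : ℝ)⁻¹ := by
  rcases Nat.eq_zero_or_pos M with rfl | h
  · simp
  have := log_add_one_le_harmonic M
  rw [harmonic_eq_sum_Icc] at this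
  push_cast at this
  refine le_trans (Real.log_le_log (by exact_mod_cast h) ?_) this
  linarith

theorem sum_Icc_dvd_inv_le (d M : ℕ) (hd : 1 ≤ d) :
    ∑ m ∈ Icc 1 M with d ∣ m, (m : ℝ)⁻¹ ≤ (d : ℝ)⁻¹ * (1 + Real.log M) := by
  calc ∑ m ∈ Icc 1 M with d ∣ m, (m : ℝ)⁻¹ ≤ ∑ k ∈ Icc 1 M, (d : ℝ)⁻¹ * (k : ℝ)⁻¹ := by
        have : ∀ m ∈ (Icc 1 M).filter (d ∣ ·), (m : ℝ)⁻¹ = (d : ℝ)⁻¹ * ((m / d : ℕ) : ℝ)⁻¹ := by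
          intro m hm
          simp only [mem_filter, mem_Icc] at hm
          rw [Nat.cast_div hm.2 (by positivity), ← mul_inv]
          congr 1; field_simp
        rw [sum_congr rfl this, ← sum_image (s := (Icc 1 M).filter (d ∣ ·)) (g := fun m ↦ m / d)
          (f := fun k : ℕ ↦ (d : ℝ)⁻¹ * (k : ℝ)⁻¹)]
        · refine sum_le_sum_of_subset_of_nonneg ?_ fun _ _ _ ↦ by positivity
          intro k hk
          simp only [mem_image, mem_filter, mem_Icc] at hk ⊢
          obtain ⟨m, ⟨⟨h1, h2⟩, h3⟩, rfl⟩ := hk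
          exact ⟨Nat.div_pos (Nat.le_of_dvd h1 h3) hd, (Nat.div_le_self _ _).trans h2⟩
        · intro m hm m' hm' h
          simp only [coe_filter, Set.mem_ofPred_eq] at hm hm' h
          rw [← Nat.div_mul_cancel hm.2, ← Nat.div_mul_cancel hm'.2, h]
    _ ≤ _ := by
        rw [← mul_sum]
        exact mul_le_mul_of_nonneg_left (sum_Icc_inv_le M) (by positivity)

/-- By Cauchy–Schwarz, (σ(m)/m)^2 is at most the sum of d^(-1/2) times the sum of d^(-3/2) over d
dividing m. The second factor is bounded, and exchanging summations in the first gives a convergent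
series times the logarithm. This controls the sieve constants on average over the cofactor m. -/
theorem exists_sum_sumInvDivisors_sq_le :
    ∃ C : ℝ, 0 < C ∧ ∀ M : ℕ, ∑ m ∈ Icc 1 M, sumInvDivisors m ^ 2 / m ≤ C * (1 + Real.log M) := by
  have hsum : Summable fun n : ℕ ↦ ((n : ℝ) ^ (3 / 2 : ℝ))⁻¹ :=
    Real.summable_nat_rpow_inv.2 (by norm_num)
  set K := ∑' n : ℕ, ((n : ℝ) ^ (3 / 2 : ℝ))⁻¹ with hK
  have hKs : ∀ s : Finset ℕ, ∑ n ∈ s, ((n : ℝ) ^ (3 / 2 : ℝ))⁻¹ ≤ K := fun s ↦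
    hsum.sum_le_tsum s fun _ _ ↦ by positivity
  have hK1 : 0 < K := lt_of_lt_of_le (by simp) (hKs {1})
  refine ⟨K * K, by positivity, fun M ↦ ?_⟩
  have h1 : ∀ m ∈ Icc 1 M, sumInvDivisors m ^ 2 / m ≤
      ∑ d ∈ Icc 1 M, if d ∣ m then K * ((d : ℝ) ^ (1 / 2 : ℝ))⁻¹ * (m : ℝ)⁻¹ else 0 := by
    intro m hm
    rw [mem_Icc] at hm
    have hcs : sumInvDivisors m ^ 2 ≤ (∑ d ∈ m.divisors, ((d : ℝ) ^ (1 / 2 : ℝ))⁻¹) *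
        ∑ d ∈ m.divisors, ((d : ℝ) ^ (3 / 2 : ℝ))⁻¹ := by
      refine sum_sq_le_sum_mul_sum_of_sq_le_mul _ (fun _ _ ↦ by positivity)
        (fun _ _ ↦ by positivity) fun d hd ↦ ?_
      have hd0 : (0 : ℝ) < d := by exact_mod_cast Nat.pos_of_mem_divisors hd
      rw [← mul_inv, ← Real.rpow_add hd0, inv_pow]
      rw [show (1 / 2 + 3 / 2 : ℝ) = (2 : ℕ) by norm_num, Real.rpow_natCast]
    have hsub : m.divisors = (Icc 1 M).filter (· ∣ m) := by
      ext d
      simp only [Nat.mem_divisors, mem_filter, mem_Icc]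
      constructor
      · rintro ⟨h, h0⟩
        exact ⟨⟨Nat.pos_of_dvd_of_pos h hm.1, (Nat.le_of_dvd hm.1 h).trans hm.2⟩, h⟩
      · rintro ⟨_, h⟩; exact ⟨h, by omega⟩
    rw [← sum_filter, ← hsub, ← sum_mul, ← mul_sum, div_eq_mul_inv]
    refine mul_le_mul_of_nonneg_right (hcs.trans ?_) (by positivity)
    rw [mul_comm]
    exact mul_le_mul_of_nonneg_right (hKs _) (sum_nonneg fun _ _ ↦ by positivity)
  have hM : (0 : ℝ) ≤ 1 + Real.log M := by
    have := Real.log_natCast_nonneg M; linarith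
  calc _ ≤ _ := sum_le_sum h1
    _ = ∑ d ∈ Icc 1 M, K * ((d : ℝ) ^ (1 / 2 : ℝ))⁻¹ * ∑ m ∈ Icc 1 M with d ∣ m, (m : ℝ)⁻¹ := by
        rw [sum_comm]
        refine sum_congr rfl fun d _ ↦ ?_
        rw [← sum_filter, mul_sum]
    _ ≤ ∑ d ∈ Icc 1 M, K * ((d : ℝ) ^ (1 / 2 : ℝ))⁻¹ * ((d : ℝ)⁻¹ * (1 + Real.log M)) := by
        refine sum_le_sum fun d hd ↦ ?_
        have := sum_Icc_dvd_inv_le d M (mem_Icc.1 hd).1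
        gcongr
    _ = K * (∑ d ∈ Icc 1 M, ((d : ℝ) ^ (3 / 2 : ℝ))⁻¹) * (1 + Real.log M) := by
        rw [mul_sum, sum_mul]
        refine sum_congr rfl fun d hd ↦ ?_
        have hd0 : (0 : ℝ) < d := by exact_mod_cast (mem_Icc.1 hd).1
        rw [show (3 / 2 : ℝ) = 1 / 2 + 1 by norm_num, Real.rpow_add hd0, Real.rpow_one, mul_inv]
        ring
    _ ≤ K * K * (1 + Real.log M) := by gcongr; exact hKs _

open ArithmeticFunction in
-- Mertens' argument: log n! is the sum of Λ(d)⌊n/d⌋ and is at most n log n. Removing the floors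
-- costs ψ(n) ≤ 6n, by Chebyshev.
theorem sum_vonMangoldt_div_le (n : ℕ) :
    ∑ d ∈ Icc 1 n, vonMangoldt d / d ≤ Real.log n + 6 := by
  rcases Nat.eq_zero_or_pos n with rfl | hn
  · simp
  have hn0 : (0 : ℝ) < n := by exact_mod_cast hn
  have hpsi : ∑ d ∈ Icc 1 n, vonMangoldt d ≤ 6 * n := by
    have h := Chebyshev.psi_le_const_mul_self hn0.le
    rw [Chebyshev.psi, Nat.floor_natCast] at h
    have h4 : Real.log 4 ≤ 2 := by
      rw [show (4 : ℝ) = 2 ^ 2 by norm_num, Real.log_pow]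
      have := Real.log_two_lt_d9; push_cast; linarith
    calc _ = ∑ d ∈ Ioc 0 n, vonMangoldt d := rfl
      _ ≤ _ := h
      _ ≤ _ := by gcongr; linarith
  have hlog : ∑ d ∈ Icc 1 n, vonMangoldt d * ((n / d : ℕ) : ℝ) ≤ n * Real.log n := by
    calc ∑ d ∈ Icc 1 n, vonMangoldt d * ((n / d : ℕ) : ℝ)
        = ∑ d ∈ Icc 1 n, ∑ m ∈ Icc 1 n, if d ∣ m then vonMangoldt d else 0 := by
          refine sum_congr rfl fun d hd ↦ ?_
          rw [← sum_filter, sum_const, nsmul_eq_mul, mul_comm]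
          have := Nat.Ioc_filter_dvd_card_eq_div n d
          rw [← this]; rfl
      _ = ∑ m ∈ Icc 1 n, Real.log m := by
          rw [sum_comm]
          refine sum_congr rfl fun m hm ↦ ?_
          rw [mem_Icc] at hm
          rw [← vonMangoldt_sum, ← sum_filter]
          refine sum_congr ?_ fun _ _ ↦ rfl
          ext d
          simp only [Nat.mem_divisors, mem_filter, mem_Icc]
          constructor
          · rintro ⟨_, h⟩; exact ⟨h, by omega⟩
          · rintro ⟨h, h0⟩
            exact ⟨⟨Nat.pos_of_dvd_of_pos h hm.1, (Nat.le_of_dvd hm.1 h).trans hm.2⟩, h⟩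
      _ ≤ ∑ m ∈ Icc 1 n, Real.log n := by
          refine sum_le_sum fun m hm ↦ ?_
          rw [mem_Icc] at hm
          exact Real.log_le_log (by exact_mod_cast hm.1) (by exact_mod_cast hm.2)
      _ = _ := by simp
  have hmul : (∑ d ∈ Icc 1 n, vonMangoldt d / d) * n ≤ (Real.log n + 6) * n := by
    calc (∑ d ∈ Icc 1 n, vonMangoldt d / d) * n
        ≤ ∑ d ∈ Icc 1 n, (vonMangoldt d * ((n / d : ℕ) : ℝ) + vonMangoldt d) := by
          rw [sum_mul]
          refine sum_le_sum fun d hd ↦ ?_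
          have hd0 : (0 : ℝ) < d := by exact_mod_cast (mem_Icc.1 hd).1
          have h1 : (n : ℝ) / d ≤ ((n / d : ℕ) : ℝ) + 1 := by
            rw [← Nat.floor_div_eq_div (K := ℝ)]
            exact (Nat.lt_floor_add_one _).le
          calc vonMangoldt d / d * n = vonMangoldt d * (n / d) := by ring
            _ ≤ vonMangoldt d * (((n / d : ℕ) : ℝ) + 1) :=
              mul_le_mul_of_nonneg_left h1 vonMangoldt_nonneg
            _ = _ := by ring
      _ ≤ _ := by rw [sum_add_distrib]; linarith
  exact le_of_mul_le_mul_right hmul hn0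

/-- Write each n as b^2 times a squarefree number; the factor 2 bounds the sum of 1/b^2. -/
theorem log_le_two_mul_sumInvSquarefree (R : ℕ) :
    Real.log R ≤ 2 * ∑ d ∈ Icc 1 R with Squarefree d, (d : ℝ)⁻¹ := by
  refine (log_le_sum_Icc_inv R).trans ?_
  have h : ∑ n ∈ Icc 1 R, (n : ℝ)⁻¹ ≤ ∑ x ∈ Icc 1 R ×ˢ ((Icc 1 R).filter Squarefree),
      ((x.1 : ℝ) ^ 2)⁻¹ * (x.2 : ℝ)⁻¹ := by
    have hex : ∀ n : ℕ, 0 < n → ∃ x : ℕ × ℕ, 0 < x.1 ∧ 0 < x.2 ∧ x.1 ^ 2 * x.2 = n ∧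
        Squarefree x.2 := by
      intro n hn
      obtain ⟨a, b, h1, h2, h3, h4⟩ := Nat.sq_mul_squarefree_of_pos hn
      exact ⟨(b, a), h2, h1, h3, h4⟩
    choose! g hg using hex
    calc ∑ n ∈ Icc 1 R, (n : ℝ)⁻¹
        = ∑ n ∈ Icc 1 R, (((g n).1 : ℝ) ^ 2)⁻¹ * ((g n).2 : ℝ)⁻¹ := by
          refine sum_congr rfl fun n hn ↦ ?_
          obtain ⟨_, _, h, _⟩ := hg n (mem_Icc.1 hn).1
          rw [← mul_inv]; norm_cast; rw [h]
      _ = ∑ x ∈ (Icc 1 R).image g, ((x.1 : ℝ) ^ 2)⁻¹ * (x.2 : ℝ)⁻¹ := by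
          rw [sum_image]
          intro n hn n' hn' h
          rw [← (hg n (mem_Icc.1 hn).1).2.2.1, ← (hg n' (mem_Icc.1 hn').1).2.2.1, h]
      _ ≤ _ := by
          refine sum_le_sum_of_subset_of_nonneg ?_ fun _ _ _ ↦ by positivity
          intro x hx
          obtain ⟨n, hn, rfl⟩ := mem_image.1 hx
          rw [mem_Icc] at hn
          obtain ⟨h1, h2, h3, h4⟩ := hg n hn.1
          simp only [mem_product, mem_Icc, mem_filter]
          have : (g n).1 ≤ (g n).1 ^ 2 * (g n).2 := by nlinarith
          have : (g n).2 ≤ (g n).1 ^ 2 * (g n).2 := Nat.le_mul_of_pos_left _ (by positivity)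
          refine ⟨⟨h1, by omega⟩, ⟨h2, by omega⟩, h4⟩
  refine h.trans ?_
  rw [sum_product]
  dsimp only
  rw [← sum_mul_sum]
  exact mul_le_mul_of_nonneg_right (sum_Icc_inv_sq_le R) (sum_nonneg fun _ _ ↦ by positivity)

/-- A squarefree d is gcd(d, B) times a number coprime to B, and the first factor ranges over
divisors of B. -/
theorem log_le_mul_sumInvSquarefreeCoprime {B : ℕ} (hB : B ≠ 0) (R : ℕ) :
    Real.log R ≤ 2 * sumInvDivisors B * sumInvSquarefreeCoprime B R := by
  refine (log_le_two_mul_sumInvSquarefree R).trans ?_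
  rw [mul_assoc]
  refine mul_le_mul_of_nonneg_left ?_ zero_le_two
  rw [sumInvDivisors, sumInvSquarefreeCoprime, sum_mul_sum, ← sum_product']
  let g : ℕ → ℕ × ℕ := fun d ↦ (d.gcd B, d / d.gcd B)
  calc ∑ d ∈ Icc 1 R with Squarefree d, (d : ℝ)⁻¹
      = ∑ d ∈ Icc 1 R with Squarefree d, ((g d).1 : ℝ)⁻¹ * ((g d).2 : ℝ)⁻¹ := by
        refine sum_congr rfl fun d _ ↦ ?_
        rw [← mul_inv]; norm_cast; rw [Nat.mul_div_cancel' (Nat.gcd_dvd_left d B)]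
    _ = ∑ x ∈ ((Icc 1 R).filter Squarefree).image g, (x.1 : ℝ)⁻¹ * (x.2 : ℝ)⁻¹ := by
        rw [sum_image]
        intro d _ d' _ h
        have h1 : d = (g d).1 * (g d).2 := (Nat.mul_div_cancel' (Nat.gcd_dvd_left d B)).symm
        have h2 : d' = (g d').1 * (g d').2 := (Nat.mul_div_cancel' (Nat.gcd_dvd_left d' B)).symm
        rw [h1, h2, h]
    _ ≤ _ := by
        refine sum_le_sum_of_subset_of_nonneg ?_ fun _ _ _ ↦ by positivity
        intro x hx
        obtain ⟨d, hd, rfl⟩ := mem_image.1 hx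
        simp only [mem_filter, mem_Icc] at hd
        have hmul : d.gcd B * (d / d.gcd B) = d := Nat.mul_div_cancel' (Nat.gcd_dvd_left d B)
        have hsq : Squarefree (d.gcd B * (d / d.gcd B)) := hmul.symm ▸ hd.2
        have hgpos : 0 < d.gcd B := Nat.gcd_pos_of_pos_left _ hd.1.1
        have hco : (d / d.gcd B).Coprime B := by
          refine Nat.coprime_of_dvd fun p hp h1 h2 ↦ ?_
          have h3 : p ∣ d.gcd B := Nat.dvd_gcd (h1.trans (Nat.div_dvd_of_dvd (Nat.gcd_dvd_left d B))) h2
          exact Nat.not_coprime_of_dvd_of_dvd hp.one_lt h3 h1 (Nat.coprime_of_squarefree_mul hsq)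
        simp only [g, mem_product, Nat.mem_divisors, mem_filter, mem_Icc]
        exact ⟨⟨Nat.gcd_dvd_right d B, hB⟩,
          ⟨Nat.div_pos (Nat.le_of_dvd hd.1.1 (Nat.gcd_dvd_left d B)) hgpos,
            (Nat.div_le_self _ _).trans hd.1.2⟩, hsq.of_mul_right, hco⟩

/-- Send (d, d') with gcd g to g and the ordered factorisation (d/g)(d'/g) of a squarefree number up
to R^2. Such a number has as many ordered factorisations as divisors, and the sum of 1/g^2 is at
most 2. The result bounds the denominator of the two-dimensional sieve below by the square of a
logarithm. -/
theorem sumInvSquarefreeCoprime_sq_le (B R : ℕ) :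
    sumInvSquarefreeCoprime B R ^ 2 ≤
      2 * ∑ d ∈ Icc 1 (R ^ 2) with Squarefree d ∧ d.Coprime B, (#d.divisors : ℝ) / d := by
  set S := (Icc 1 R).filter fun d ↦ Squarefree d ∧ d.Coprime B with hS
  set T := (Icc 1 (R ^ 2)).filter fun d ↦ Squarefree d ∧ d.Coprime B with hT
  have hdiv : ∑ d ∈ T, (#d.divisors : ℝ) / d =
      ∑ y ∈ T.sigma fun d ↦ d.divisorsAntidiagonal, ((y.2.1 : ℝ))⁻¹ * ((y.2.2 : ℝ))⁻¹ := by
    rw [sum_sigma]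
    refine sum_congr rfl fun d hd ↦ ?_
    have : ∀ y ∈ d.divisorsAntidiagonal, ((y.1 : ℝ))⁻¹ * ((y.2 : ℝ))⁻¹ = (d : ℝ)⁻¹ := by
      intro y hy
      rw [← mul_inv]; norm_cast; rw [(Nat.mem_divisorsAntidiagonal.1 hy).1]
    rw [sum_congr rfl this, sum_const, nsmul_eq_mul, div_eq_mul_inv]
    congr 2
    rw [← Nat.map_div_right_divisors, card_map]
  rw [hdiv]
  let g : ℕ × ℕ → ℕ × (Σ _ : ℕ, ℕ × ℕ) := fun x ↦
    (x.1.gcd x.2, ⟨x.1 / x.1.gcd x.2 * (x.2 / x.1.gcd x.2), (x.1 / x.1.gcd x.2, x.2 / x.1.gcd x.2)⟩)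
  have e1 : ∀ x : ℕ × ℕ, x.1.gcd x.2 * (x.1 / x.1.gcd x.2) = x.1 := fun x ↦
    Nat.mul_div_cancel' (Nat.gcd_dvd_left _ _)
  have e2 : ∀ x : ℕ × ℕ, x.1.gcd x.2 * (x.2 / x.1.gcd x.2) = x.2 := fun x ↦
    Nat.mul_div_cancel' (Nat.gcd_dvd_right _ _)
  calc sumInvSquarefreeCoprime B R ^ 2
      = ∑ x ∈ S ×ˢ S, (x.1 : ℝ)⁻¹ * (x.2 : ℝ)⁻¹ := by
        rw [sq, sumInvSquarefreeCoprime, sum_mul_sum, ← sum_product']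
    _ = ∑ x ∈ S ×ˢ S, (((g x).1 : ℝ) ^ 2)⁻¹ *
          (((g x).2.2.1 : ℝ)⁻¹ * ((g x).2.2.2 : ℝ)⁻¹) := by
        refine sum_congr rfl fun x _ ↦ ?_
        rw [← mul_inv, ← mul_inv, ← mul_inv]
        congr 1
        have h1 : (x.1 : ℝ) = (g x).1 * (g x).2.2.1 := by exact_mod_cast (e1 x).symm
        have h2 : (x.2 : ℝ) = (g x).1 * (g x).2.2.2 := by exact_mod_cast (e2 x).symm
        rw [h1, h2]; ring
    _ = ∑ z ∈ (S ×ˢ S).image g, ((z.1 : ℝ) ^ 2)⁻¹ * ((z.2.2.1 : ℝ)⁻¹ * (z.2.2.2 : ℝ)⁻¹) := by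
        rw [sum_image]
        intro x _ x' _ h
        have h1 : (x.1, x.2) = ((g x).1 * (g x).2.2.1, (g x).1 * (g x).2.2.2) :=
          Prod.ext (e1 x).symm (e2 x).symm
        have h2 : (x'.1, x'.2) = ((g x').1 * (g x').2.2.1, (g x').1 * (g x').2.2.2) :=
          Prod.ext (e1 x').symm (e2 x').symm
        rw [h] at h1
        exact h1.trans h2.symm
    _ ≤ ∑ z ∈ Icc 1 R ×ˢ T.sigma fun d ↦ d.divisorsAntidiagonal,
          ((z.1 : ℝ) ^ 2)⁻¹ * ((z.2.2.1 : ℝ)⁻¹ * (z.2.2.2 : ℝ)⁻¹) := by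
        refine sum_le_sum_of_subset_of_nonneg ?_ fun _ _ _ ↦ by positivity
        intro z hz
        obtain ⟨x, hx, rfl⟩ := mem_image.1 hz
        simp only [hS, mem_product, mem_filter, mem_Icc] at hx
        obtain ⟨⟨⟨a1, a2⟩, a3, a4⟩, ⟨b1, b2⟩, b3, b4⟩ := hx
        have hg0 : 0 < x.1.gcd x.2 := Nat.gcd_pos_of_pos_left _ a1
        have d1 : x.1 / x.1.gcd x.2 ∣ x.1 := Nat.div_dvd_of_dvd (Nat.gcd_dvd_left _ _)
        have d2 : x.2 / x.1.gcd x.2 ∣ x.2 := Nat.div_dvd_of_dvd (Nat.gcd_dvd_right _ _)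
        have p1 := Nat.pos_of_dvd_of_pos d1 a1
        have p2 := Nat.pos_of_dvd_of_pos d2 b1
        have l1 := (Nat.le_of_dvd a1 d1).trans a2
        have l2 := (Nat.le_of_dvd b1 d2).trans b2
        have hco : (x.1 / x.1.gcd x.2).Coprime (x.2 / x.1.gcd x.2) :=
          Nat.coprime_div_gcd_div_gcd hg0
        simp only [g, hT, mem_product, mem_sigma, mem_filter, mem_Icc,
          Nat.mem_divisorsAntidiagonal]
        refine ⟨⟨hg0, (Nat.gcd_le_left _ a1).trans a2⟩, ⟨⟨Nat.mul_pos p1 p2, ?_⟩, ?_, ?_⟩,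
          trivial, (Nat.mul_pos p1 p2).ne'⟩
        · rw [sq]; exact Nat.mul_le_mul l1 l2
        · exact (Nat.squarefree_mul hco).2 ⟨a3.squarefree_of_dvd d1, b3.squarefree_of_dvd d2⟩
        · exact Nat.Coprime.mul_left (a4.coprime_dvd_left d1) (b4.coprime_dvd_left d2)
    _ ≤ _ := by
        rw [sum_product]; dsimp only; rw [← sum_mul_sum]
        exact mul_le_mul_of_nonneg_right (sum_Icc_inv_sq_le R)
          (sum_nonneg fun _ _ ↦ by positivity)

end

/-! ### Sieving one linear form and the product of two. -/

section
open Finset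

theorem abs_card_filter_modEq_sub_le (n r : ℕ) {e : ℕ} (he : 0 < e) :
    |(#{j ∈ Icc 1 n | j ≡ r [MOD e]} : ℝ) - n / e| ≤ 1 := by
  have h := Nat.Ioc_filter_modEq_card (a := 0) (b := n) he r
  have h0 : Ioc 0 n = Icc 1 n := rfl
  rw [h0] at h
  have hmono : ⌊(((0 : ℕ) : ℚ) - r) / e⌋ ≤ ⌊((n : ℚ) - r) / e⌋ := by
    apply Int.floor_le_floor; gcongr; simp
  rw [max_eq_left (by linarith)] at h
  set A := ⌊((n : ℚ) - r) / e⌋ with hA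
  set C := ⌊(((0 : ℕ) : ℚ) - r) / e⌋ with hC
  have a1 := Int.floor_le (((n : ℚ) - r) / e)
  have a2 := Int.lt_floor_add_one (((n : ℚ) - r) / e)
  have c1 := Int.floor_le ((((0 : ℕ) : ℚ) - r) / e)
  have c2 := Int.lt_floor_add_one ((((0 : ℕ) : ℚ) - r) / e)
  rw [← hA] at a1 a2
  rw [← hC] at c1 c2
  have hsub : ((n : ℚ) - r) / e - (((0 : ℕ) : ℚ) - r) / e = n / e := by simp; ring
  have hq : |((#{j ∈ Icc 1 n | j ≡ r [MOD e]} : ℕ) : ℚ) - n / e| ≤ 1 := by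
    have : ((#{j ∈ Icc 1 n | j ≡ r [MOD e]} : ℕ) : ℚ) = A - C := by exact_mod_cast h
    rw [this, abs_le]; constructor <;> linarith
  have := (Rat.cast_le (K := ℝ)).2 hq
  push_cast at this
  exact this

theorem exists_dvd_linear_iff_modEq {c : ℤ} (b : ℤ) {e : ℕ} (he : 0 < e)
    (hc : IsCoprime c (e : ℤ)) :
    ∃ r : ℕ, ∀ j : ℕ, (e : ℤ) ∣ c * j - b ↔ j ≡ r [MOD e] := by
  obtain ⟨u, v, huv⟩ := hc
  have he' : (e : ℤ) ≠ 0 := by exact_mod_cast he.ne'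
  refine ⟨((u * b) % e).toNat, fun j ↦ ?_⟩
  rw [← Int.natCast_modEq_iff, Int.toNat_of_nonneg (Int.emod_nonneg _ he')]
  have h1 : (j : ℤ) ≡ u * b % e [ZMOD e] ↔ (j : ℤ) ≡ u * b [ZMOD e] := by
    simp [Int.ModEq]
  rw [h1, Int.modEq_comm, Int.modEq_iff_dvd]
  constructor
  · intro h
    have : (j : ℤ) - u * b = u * (c * j - b) + e * (v * j) := by
      linear_combination (- (j : ℤ)) * huv
    rw [this]
    exact dvd_add (h.mul_left _) (dvd_mul_right _ _)
  · intro h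
    have : c * (j : ℤ) - b = c * (j - u * b) - e * (v * b) := by
      linear_combination b * huv
    rw [this]
    exact dvd_sub (h.mul_left _) (dvd_mul_right _ _)

/-- The product of the primes `p ≤ R` that do not divide `B`. -/
noncomputable def siftingProduct (B R : ℕ) : ℕ := ∏ p ∈ Icc 1 R with p.Prime ∧ ¬ p ∣ B, p

theorem prime_dvd_siftingProduct_iff {B R p : ℕ} (hp : p.Prime) :
    p ∣ siftingProduct B R ↔ p ≤ R ∧ ¬ p ∣ B := by
  rw [siftingProduct, hp.prime.dvd_finsetProd_iff]
  constructor
  · rintro ⟨q, hq, hpq⟩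
    simp only [mem_filter, mem_Icc] at hq
    rw [(Nat.prime_dvd_prime_iff_eq hp hq.2.1).1 hpq]
    exact ⟨hq.1.2, hq.2.2⟩
  · rintro ⟨h1, h2⟩
    exact ⟨p, by simp [hp.one_le, h1, hp, h2], dvd_rfl⟩

theorem siftingProduct_ne_zero (B R : ℕ) : siftingProduct B R ≠ 0 := by
  refine prod_ne_zero_iff.2 fun p hp ↦ ?_
  simp only [mem_filter, mem_Icc] at hp
  omega

theorem squarefree_siftingProduct (B R : ℕ) : Squarefree (siftingProduct B R) := by
  refine Finset.squarefree_prod_of_pairwise_isCoprime ?_ ?_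
  · intro p hp q hq hpq
    simp only [coe_filter, Set.mem_ofPred_eq] at hp hq
    exact Nat.coprime_iff_isRelPrime.1 ((Nat.coprime_primes hp.2.1 hq.2.1).2 hpq)
  · intro p hp
    exact (mem_filter.1 hp).2.1.prime.squarefree

theorem dvd_siftingProduct_of {B R d : ℕ} (hd : d ≤ R) (hd0 : Squarefree d)
    (hB : d.Coprime B) : d ∣ siftingProduct B R := by
  rw [← Nat.prod_primeFactors_of_squarefree hd0, siftingProduct]
  refine prod_dvd_prod_of_subset _ _ _ fun p hp ↦ ?_
  have hpp := Nat.prime_of_mem_primeFactors hp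
  have hpd := Nat.dvd_of_mem_primeFactors hp
  simp only [mem_filter, mem_Icc]
  exact ⟨⟨hpp.one_le, (Nat.le_of_dvd (Nat.pos_of_ne_zero hd0.ne_zero) hpd).trans hd⟩, hpp,
    fun h ↦ Nat.not_coprime_of_dvd_of_dvd hpp.one_lt hpd h hB⟩

theorem coprime_of_dvd_siftingProduct {B R d : ℕ} (hd : d ∣ siftingProduct B R) :
    d.Coprime B :=
  Nat.coprime_of_dvd fun _ hp h1 h2 ↦ ((prime_dvd_siftingProduct_iff hp).1 (h1.trans hd)).2 h2

/-- A number up to R has no prime factor above R, so cutting the sifting primes at R loses no term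
of the sieve denominator. -/
theorem filter_divisors_siftingProduct (B R : ℕ) :
    (siftingProduct B R).divisors.filter (· ≤ R) =
      (Icc 1 R).filter fun d ↦ Squarefree d ∧ d.Coprime B := by
  ext d
  simp only [mem_filter, Nat.mem_divisors, mem_Icc]
  constructor
  · rintro ⟨⟨h1, h2⟩, h3⟩
    exact ⟨⟨Nat.pos_of_ne_zero (ne_zero_of_dvd_ne_zero h2 h1), h3⟩,
      (squarefree_siftingProduct B R).squarefree_of_dvd h1, coprime_of_dvd_siftingProduct h1⟩
  · rintro ⟨⟨h1, h2⟩, h3, h4⟩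
    exact ⟨⟨dvd_siftingProduct_of h2 h3 h4, siftingProduct_ne_zero B R⟩, h2⟩

theorem isCoprime_of_coprime_of_dvd {B e : ℕ} {c : ℤ} (hB : e.Coprime B) (hc : c ∣ B) :
    IsCoprime c (e : ℤ) :=
  (IsCoprime.of_isCoprime_of_dvd_left (Nat.isCoprime_iff_coprime.2 hB.symm) hc)

open scoped Classical in
/-- Upper bound sieve for the values of a linear polynomial. -/
theorem card_sifted_linear_le {B : ℕ} (hB : B ≠ 0) {c : ℤ} (hc : c ∣ B) (b : ℤ) (n : ℕ) {R : ℕ}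
    (hR : 2 ≤ R) :
    (#{j ∈ Icc 1 n | ∀ p : ℕ, p.Prime → p ≤ R → ¬ p ∣ B → ¬ (p : ℤ) ∣ c * (j : ℕ) - b} : ℝ) ≤
      2 * sumInvDivisors B * n / Real.log R + (R : ℝ) ^ 6 := by
  let ν : ArithmeticFunction ℝ := ⟨fun d ↦ (d : ℝ)⁻¹, by simp⟩
  have hνd : ∀ d : ℕ, ν d = (d : ℝ)⁻¹ := fun d ↦ rfl
  have hν : ν.IsMultiplicative := by
    refine ⟨by simp [hνd], fun _ ↦ ?_⟩
    simp only [hνd]; push_cast; exact mul_inv _ _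
  have h := card_filter_not_dvd_le_selberg n (fun j ↦ c * j - b)
    (squarefree_siftingProduct B R) ν hν
    (fun p hp _ ↦ by rw [hνd]; have := hp.pos; positivity)
    (fun p hp _ ↦ by
      rw [hνd]; exact inv_lt_one_of_one_lt₀ (by exact_mod_cast hp.one_lt))
    (by omega : 1 ≤ R) (fun d _ ↦ by rw [hνd, inv_inv])
    (fun d hd ↦ by
      have hd0 : 0 < d := Nat.pos_of_ne_zero (ne_zero_of_dvd_ne_zero (siftingProduct_ne_zero B R) hd)
      obtain ⟨r, hr⟩ := exists_dvd_linear_iff_modEq b hd0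
        (isCoprime_of_coprime_of_dvd (coprime_of_dvd_siftingProduct hd) hc)
      have h1 := abs_card_filter_modEq_sub_le n r hd0
      have h2 : (Icc 1 n).filter (fun j : ℕ ↦ (d : ℤ) ∣ c * j - b) =
          (Icc 1 n).filter fun j ↦ j ≡ r [MOD d] := filter_congr fun j _ ↦ hr j
      rw [hνd, inv_mul_eq_div]
      have h3 : (1 : ℝ) ≤ d := by exact_mod_cast hd0
      rw [← h2] at h1
      convert h1.trans h3 using 4)
  rw [filter_divisors_siftingProduct] at h
  have hlog : 0 < Real.log R := Real.log_pos (by exact_mod_cast hR)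
  have hS := log_le_mul_sumInvSquarefreeCoprime hB R
  have hs := one_le_sumInvDivisors hB
  have hT : 0 < sumInvSquarefreeCoprime B R := by
    by_contra hT
    have : 2 * sumInvDivisors B * sumInvSquarefreeCoprime B R ≤ 0 :=
      mul_nonpos_of_nonneg_of_nonpos (by linarith) (not_lt.1 hT)
    linarith
  refine le_trans (le_of_eq ?_) (h.trans (add_le_add ?_ le_rfl))
  · refine congrArg (fun s : Finset ℕ ↦ (#s : ℝ)) (filter_congr fun j _ ↦ ?_)
    refine forall_congr' fun p ↦ forall_congr' fun hp ↦ ?_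
    rw [prime_dvd_siftingProduct_iff hp, and_imp]
  · change (n : ℝ) / sumInvSquarefreeCoprime B R ≤ _
    rw [div_le_div_iff₀ hT hlog]
    calc (n : ℝ) * Real.log R ≤ n * (2 * sumInvDivisors B * sumInvSquarefreeCoprime B R) := by gcongr
      _ = _ := by ring

/-- A prime dividing both forms divides their determinant, hence `B`, so it cannot divide d. Each
solution j thus determines a factorisation d = uv, with u dividing the first form and v the second,
and each factorisation gives one residue class modulo d by the Chinese remainder theorem. Each class
has counting error at most 1. -/
theorem abs_card_filter_dvd_mul_linear_le {c₁ b₁ c₂ b₂ : ℤ} {B : ℕ} (h₁ : c₁ ∣ B) (h₂ : c₂ ∣ B)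
    (h₃ : c₁ * b₂ - c₂ * b₁ ∣ B) (n : ℕ) {d : ℕ} (hd : Squarefree d) (hdB : d.Coprime B) :
    |(#{j ∈ Icc 1 n | (d : ℤ) ∣ (c₁ * (j : ℕ) - b₁) * (c₂ * j - b₂)} : ℝ) -
      #d.divisors / d * n| ≤ d := by
  have hd0 : 0 < d := Nat.pos_of_ne_zero hd.ne_zero
  have hcommon : ∀ (p j : ℕ), p.Prime → p ∣ d → (p : ℤ) ∣ c₁ * j - b₁ → (p : ℤ) ∣ c₂ * j - b₂ →
      False := by
    intro p j hp hpd hp1 hp2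
    have : (p : ℤ) ∣ c₁ * b₂ - c₂ * b₁ := by
      have h := dvd_sub (hp1.mul_left c₂) (hp2.mul_left c₁)
      have e : c₂ * (c₁ * (j : ℤ) - b₁) - c₁ * (c₂ * j - b₂) = c₁ * b₂ - c₂ * b₁ := by ring
      rwa [e] at h
    exact Nat.not_coprime_of_dvd_of_dvd hp.one_lt hpd (by exact_mod_cast this.trans h₃) hdB
  let g : ℕ → ℕ × ℕ := fun j ↦
    (d.gcd (c₁ * j - b₁).natAbs, d / d.gcd (c₁ * j - b₁).natAbs)
  have hg : ∀ j ∈ (Icc 1 n).filter (fun j : ℕ ↦ (d : ℤ) ∣ (c₁ * j - b₁) * (c₂ * j - b₂)),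
      g j ∈ d.divisorsAntidiagonal := by
    intro j _
    rw [Nat.mem_divisorsAntidiagonal]
    exact ⟨Nat.mul_div_cancel' (Nat.gcd_dvd_left _ _), hd0.ne'⟩
  have hfib : ∀ y ∈ d.divisorsAntidiagonal,
      |(#{j ∈ (Icc 1 n).filter (fun j : ℕ ↦ (d : ℤ) ∣ (c₁ * j - b₁) * (c₂ * j - b₂)) | g j = y} : ℝ)
        - n / d| ≤ 1 := by
    rintro ⟨u, v⟩ hy
    rw [Nat.mem_divisorsAntidiagonal] at hy
    obtain ⟨huv, -⟩ := hy
    simp only at huv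
    have hco : u.Coprime v := Nat.coprime_of_squarefree_mul (huv ▸ hd)
    have hu : u ∣ d := ⟨v, huv.symm⟩
    have hv : v ∣ d := ⟨u, by rw [← huv, mul_comm]⟩
    have hu0 := Nat.pos_of_dvd_of_pos hu hd0
    have hv0 := Nat.pos_of_dvd_of_pos hv hd0
    have hset : ((Icc 1 n).filter (fun j : ℕ ↦ (d : ℤ) ∣ (c₁ * j - b₁) * (c₂ * j - b₂))).filter
        (fun j ↦ g j = (u, v)) =
        (Icc 1 n).filter fun j : ℕ ↦ (u : ℤ) ∣ c₁ * j - b₁ ∧ (v : ℤ) ∣ c₂ * j - b₂ := by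
      ext j
      simp only [mem_filter, and_assoc, g, Prod.mk.injEq]
      refine and_congr_right fun _ ↦ ?_
      have hvco : ∀ p : ℕ, p.Prime → p ∣ v → (p : ℤ) ∣ c₁ * j - b₁ →
          ¬ d.gcd (c₁ * j - b₁).natAbs ∣ u := by
        intro p hp hpv hp1 h2
        have : p ∣ u := (Nat.dvd_gcd (hpv.trans hv) (Int.natCast_dvd.1 hp1)).trans h2
        exact Nat.not_coprime_of_dvd_of_dvd hp.one_lt this hpv hco
      constructor
      · rintro ⟨hdvd, hgu, -⟩
        have hu1 : (u : ℤ) ∣ c₁ * j - b₁ := Int.natCast_dvd.2 (hgu ▸ Nat.gcd_dvd_right _ _)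
        refine ⟨hu1, ?_⟩
        have hcop : v.Coprime (c₁ * j - b₁).natAbs := Nat.coprime_of_dvd fun p hp hpv hp1 ↦
          hvco p hp hpv (Int.natCast_dvd.2 hp1) hgu.dvd
        have h3 : (v : ℤ) ∣ (c₁ * j - b₁) * (c₂ * j - b₂) :=
          (Int.natCast_dvd_natCast.2 hv).trans hdvd
        rw [Int.natCast_dvd, Int.natAbs_mul] at h3
        exact Int.natCast_dvd.2 (hcop.dvd_of_dvd_mul_left h3)
      · rintro ⟨hu1, hv2⟩
        have hcop : v.Coprime (c₁ * j - b₁).natAbs := Nat.coprime_of_dvd fun p hp hpv hp1 ↦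
          hcommon p j hp (hpv.trans hv) (Int.natCast_dvd.2 hp1)
            ((Int.natCast_dvd_natCast.2 hpv).trans hv2)
        have hgu : d.gcd (c₁ * j - b₁).natAbs = u := by
          rw [← huv, Nat.Coprime.gcd_mul_right_cancel _ hcop,
            Nat.gcd_eq_left (Int.natCast_dvd.1 hu1)]
        refine ⟨?_, hgu, ?_⟩
        · rw [← huv]; push_cast; exact mul_dvd_mul hu1 hv2
        · rw [hgu, ← huv, Nat.mul_div_cancel_left _ hu0]
    obtain ⟨r₁, hr₁⟩ := exists_dvd_linear_iff_modEq b₁ hu0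
      (isCoprime_of_coprime_of_dvd (hdB.coprime_dvd_left hu) h₁)
    obtain ⟨r₂, hr₂⟩ := exists_dvd_linear_iff_modEq b₂ hv0
      (isCoprime_of_coprime_of_dvd (hdB.coprime_dvd_left hv) h₂)
    obtain ⟨r, hru, hrv⟩ := Nat.chineseRemainder hco r₁ r₂
    have hset2 : (Icc 1 n).filter (fun j : ℕ ↦ (u : ℤ) ∣ c₁ * j - b₁ ∧ (v : ℤ) ∣ c₂ * j - b₂) =
        (Icc 1 n).filter fun j ↦ j ≡ r [MOD d] := by
      refine filter_congr fun j _ ↦ ?_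
      rw [hr₁, hr₂, ← huv, ← Nat.modEq_and_modEq_iff_modEq_mul hco]
      exact and_congr ⟨fun h ↦ h.trans hru.symm, fun h ↦ h.trans hru⟩
        ⟨fun h ↦ h.trans hrv.symm, fun h ↦ h.trans hrv⟩
    rw [hset, hset2]
    exact abs_card_filter_modEq_sub_le n r hd0
  have hcard : #d.divisorsAntidiagonal = #d.divisors := by
    rw [← Nat.map_div_right_divisors, card_map]
  rw [card_eq_sum_card_fiberwise hg]
  push_cast
  have : (#d.divisors : ℝ) / d * n = ∑ _y ∈ d.divisorsAntidiagonal, (n : ℝ) / d := by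
    rw [sum_const, nsmul_eq_mul, hcard]; ring
  rw [this, ← sum_sub_distrib]
  calc _ ≤ ∑ y ∈ d.divisorsAntidiagonal, (1 : ℝ) :=
        (abs_sum_le_sum_abs _ _).trans (sum_le_sum hfib)
    _ = #d.divisors := by simp [hcard]
    _ ≤ d := by exact_mod_cast Nat.card_divisors_le_self d

open scoped Classical in
/-- Upper bound sieve for the values of a product of two linear polynomials. -/
theorem card_sifted_mul_linear_le {c₁ b₁ c₂ b₂ : ℤ} {B : ℕ} (hB : B ≠ 0) (h2B : 2 ∣ B)
    (h₁ : c₁ ∣ B) (h₂ : c₂ ∣ B) (h₃ : c₁ * b₂ - c₂ * b₁ ∣ B) (n : ℕ) {R : ℕ} (hR : 2 ≤ R) :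
    (#{j ∈ Icc 1 n | ∀ p : ℕ, p.Prime → p ≤ R ^ 2 → ¬ p ∣ B →
      ¬ (p : ℤ) ∣ (c₁ * (j : ℕ) - b₁) * (c₂ * j - b₂)} : ℝ) ≤
      8 * sumInvDivisors B ^ 2 * n / Real.log R ^ 2 + (R : ℝ) ^ 12 := by
  let ν : ArithmeticFunction ℝ := ⟨fun d ↦ (#d.divisors : ℝ) / d, by simp⟩
  have hνd : ∀ d : ℕ, ν d = (#d.divisors : ℝ) / d := fun d ↦ rfl
  have hν : ν.IsMultiplicative := by
    refine ⟨by simp [hνd], fun {m n} hmn ↦ ?_⟩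
    simp only [hνd]
    rw [hmn.card_divisors_mul]; push_cast
    exact mul_div_mul_comm _ _ _ _
  have h := card_filter_not_dvd_le_selberg n (fun j ↦ (c₁ * j - b₁) * (c₂ * j - b₂))
    (squarefree_siftingProduct B (R ^ 2)) ν hν
    (fun p hp _ ↦ by
      rw [hνd]
      have h1 := hp.pos
      have h2 : 0 < #p.divisors := card_pos.2 ⟨1, by simp [hp.ne_zero]⟩
      positivity)
    (fun p hp hpP ↦ by
      have h1 : 0 < p := hp.pos
      -- The density 2/p is below 1 only for odd p, which is why 2 must divide `B`.
      have h2 : 2 < p := by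
        refine lt_of_le_of_ne hp.two_le ?_
        rintro rfl
        exact ((prime_dvd_siftingProduct_iff hp).1 hpP).2 h2B
      have h3 : #p.divisors = 2 := by
        rw [hp.divisors, card_pair hp.one_lt.ne]
      rw [hνd, h3, div_lt_one (by positivity)]
      exact_mod_cast h2)
    -- The level is R^2 because the square of the squarefree sum up to R is dominated by a divisor
    -- sum up to R^2; hence the error (R^2)^6.
    (Nat.one_le_pow _ _ (by omega) : 1 ≤ R ^ 2)
    (fun d hd ↦ by
      have hd0 : 0 < d := Nat.pos_of_ne_zero
        (ne_zero_of_dvd_ne_zero (siftingProduct_ne_zero B (R ^ 2)) hd)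
      have h2 : 0 < #d.divisors := card_pos.2 ⟨1, by simp [hd0.ne']⟩
      rw [hνd, inv_div]
      exact div_le_self (by positivity) (by exact_mod_cast h2))
    (fun d hd ↦ by
      rw [hνd]
      refine le_trans (le_of_eq ?_) (abs_card_filter_dvd_mul_linear_le h₁ h₂ h₃ n
        ((squarefree_siftingProduct B (R ^ 2)).squarefree_of_dvd hd)
        (coprime_of_dvd_siftingProduct hd))
      congr! 4)
  rw [filter_divisors_siftingProduct] at h
  have hlog : 0 < Real.log R := Real.log_pos (by exact_mod_cast hR)
  have hS := log_le_mul_sumInvSquarefreeCoprime hB R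
  have hs := one_le_sumInvDivisors hB
  have hT2 := sumInvSquarefreeCoprime_sq_le B R
  have hsq : Real.log R ^ 2 ≤ 8 * sumInvDivisors B ^ 2 *
      ∑ d ∈ Icc 1 (R ^ 2) with Squarefree d ∧ d.Coprime B, (#d.divisors : ℝ) / d := by
    calc Real.log R ^ 2 ≤ (2 * sumInvDivisors B * sumInvSquarefreeCoprime B R) ^ 2 := by gcongr
      _ = 4 * sumInvDivisors B ^ 2 * sumInvSquarefreeCoprime B R ^ 2 := by ring
      _ ≤ 4 * sumInvDivisors B ^ 2 * (2 *
        ∑ d ∈ Icc 1 (R ^ 2) with Squarefree d ∧ d.Coprime B, (#d.divisors : ℝ) / d) := by gcongr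
      _ = _ := by ring
  have hT : 0 < ∑ d ∈ Icc 1 (R ^ 2) with Squarefree d ∧ d.Coprime B, (#d.divisors : ℝ) / d := by
    by_contra hT
    have : 8 * sumInvDivisors B ^ 2 *
      ∑ d ∈ Icc 1 (R ^ 2) with Squarefree d ∧ d.Coprime B, (#d.divisors : ℝ) / d ≤ 0 :=
      mul_nonpos_of_nonneg_of_nonpos (by positivity) (not_lt.1 hT)
    have : 0 < Real.log R ^ 2 := by positivity
    linarith
  refine le_trans (le_of_eq ?_) (h.trans (add_le_add ?_ (le_of_eq ?_)))
  · refine congrArg (fun s : Finset ℕ ↦ (#s : ℝ)) (filter_congr fun j _ ↦ ?_)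
    refine forall_congr' fun p ↦ forall_congr' fun hp ↦ ?_
    rw [prime_dvd_siftingProduct_iff hp, and_imp]
  · change (n : ℝ) / (∑ d ∈ Icc 1 (R ^ 2) with Squarefree d ∧ d.Coprime B, (#d.divisors : ℝ) / d) ≤ _
    rw [div_le_div_iff₀ hT (by positivity)]
    calc (n : ℝ) * Real.log R ^ 2 ≤ n * (8 * sumInvDivisors B ^ 2 *
        ∑ d ∈ Icc 1 (R ^ 2) with Squarefree d ∧ d.Coprime B, (#d.divisors : ℝ) / d) := by gcongr
      _ = _ := by ring
  · push_cast; ring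

end

/-! ### Shifted primes subject to divisibility conditions. -/

section
open Finset

theorem card_filter_exists_le {ι : Type*} (S : Finset ℕ) (I : Finset ι) (P : ι → ℕ → Prop)
    [∀ i, DecidablePred (P i)] [DecidablePred fun p ↦ ∃ i ∈ I, P i p] (b : ι → ℝ)
    (h : ∀ i ∈ I, (#{p ∈ S | P i p} : ℝ) ≤ b i) :
    (#{p ∈ S | ∃ i ∈ I, P i p} : ℝ) ≤ ∑ i ∈ I, b i := by
  have h1 : S.filter (fun p ↦ ∃ i ∈ I, P i p) ⊆ I.biUnion fun i ↦ S.filter (P i) := by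
    intro p hp
    simp only [mem_filter, mem_biUnion] at hp ⊢
    obtain ⟨hp, i, hi, hpi⟩ := hp
    exact ⟨i, hi, hp, hpi⟩
  have h2 : #(S.filter fun p ↦ ∃ i ∈ I, P i p) ≤ ∑ i ∈ I, #(S.filter (P i)) :=
    (card_le_card h1).trans card_biUnion_le
  calc (#{p ∈ S | ∃ i ∈ I, P i p} : ℝ) ≤ ((∑ i ∈ I, #(S.filter (P i)) : ℕ) : ℝ) := by
        exact_mod_cast h2
    _ ≤ _ := by push_cast; exact sum_le_sum h

/-- The primes in the interval `(√x, x]`. -/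
def largePrimes (x : ℕ) : Finset ℕ := {p ∈ Icc 1 x | p.Prime ∧ x < p ^ 2}

theorem mem_largePrimes {x p : ℕ} : p ∈ largePrimes x ↔ p ≤ x ∧ p.Prime ∧ x < p ^ 2 := by
  simp only [largePrimes, mem_filter, mem_Icc]
  exact ⟨fun h ↦ ⟨h.1.2, h.2⟩, fun h ↦ ⟨⟨h.2.1.one_le, h.1⟩, h.2⟩⟩

/-- From a^2 ≤ x < p^2 it follows that |a| < p ≤ x. -/
theorem exists_shift_eq {x p : ℕ} {a : ℤ} (ha : a ^ 2 ≤ x) (hp : p ∈ largePrimes x) :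
    ∃ N : ℕ, (N : ℤ) = p + a ∧ 1 ≤ N ∧ N ≤ 2 * x := by
  rw [mem_largePrimes] at hp
  obtain ⟨h1, -, h2⟩ := hp
  have h3 : |a| < |(p : ℤ)| := sq_lt_sq.1 (by exact_mod_cast ha.trans_lt (by exact_mod_cast h2))
  rw [Nat.abs_cast] at h3
  have := neg_abs_le a
  have := le_abs_self a
  exact ⟨(p + a).toNat, by omega, by omega, by omega⟩

/-- R is the floor of t = x^(1/100). Since R ≥ 2, t ≤ R + 1 ≤ R^2, which turns the factor 100 into
200. The small exponent keeps the sieve errors R^6 and R^12 negligible. -/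
theorem exists_sieve_level {x : ℕ} (hx : 2 ^ 100 ≤ x) :
    ∃ R : ℕ, 2 ≤ R ∧ R ^ 100 ≤ x ∧ Real.log x ≤ 200 * Real.log R := by
  have hx0 : (0 : ℝ) ≤ x := by positivity
  set t : ℝ := (x : ℝ) ^ (1 / 100 : ℝ) with ht
  have ht0 : 0 ≤ t := by positivity
  have ht100 : t ^ 100 = x := by
    rw [ht, ← Real.rpow_natCast, ← Real.rpow_mul hx0]; norm_num
  have ht2 : 2 ≤ t := by
    by_contra h
    have h1 : t ^ 100 < 2 ^ 100 := pow_lt_pow_left₀ (not_le.1 h) ht0 (by norm_num)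
    rw [ht100] at h1
    have h2 : ((2 ^ 100 : ℕ) : ℝ) ≤ x := by exact_mod_cast hx
    push_cast at h2
    linarith
  have hR2 : 2 ≤ ⌊t⌋₊ := Nat.le_floor (by exact_mod_cast ht2)
  refine ⟨⌊t⌋₊, hR2, ?_, ?_⟩
  · have : ((⌊t⌋₊ : ℝ)) ^ 100 ≤ t ^ 100 := by gcongr; exact Nat.floor_le ht0
    rw [ht100] at this
    exact_mod_cast this
  · have h1 : t ≤ (⌊t⌋₊ : ℝ) ^ 2 := by
      have h2 := (Nat.lt_floor_add_one t).le
      have h3 : (2 : ℝ) ≤ ⌊t⌋₊ := by exact_mod_cast hR2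
      nlinarith
    rw [← ht100, Real.log_pow]
    have h4 := Real.log_le_log (by linarith) h1
    rw [Real.log_pow] at h4
    push_cast at h4 ⊢
    linarith

theorem pow_le_rpow_of_pow_le {R x : ℕ} (hR : R ^ 100 ≤ x) (k : ℕ) :
    (R : ℝ) ^ k ≤ (x : ℝ) ^ ((k : ℝ) / 100) := by
  have h : ((R : ℝ) ^ 100) ≤ x := by exact_mod_cast hR
  calc (R : ℝ) ^ k = ((R : ℝ) ^ 100) ^ ((k : ℝ) / 100) := by
        rw [← Real.rpow_natCast, ← Real.rpow_natCast, ← Real.rpow_mul (by positivity)]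
        congr 1; push_cast; ring
    _ ≤ _ := by gcongr

/-- An upper bound of Brun–Titchmarsh type for shifted primes. -/
theorem card_largePrimes_dvd_le {a : ℤ} {x D : ℕ} (hx : 2 ^ 100 ≤ x) (ha : a ^ 2 ≤ x)
    (hD : 1 ≤ D) :
    (#{p ∈ largePrimes x | (D : ℤ) ∣ ((p : ℕ) : ℤ) + a} : ℝ) ≤
      800 * sumInvDivisors D * x / (D * Real.log x) + (x : ℝ) ^ (1 / 10 : ℝ) := by
  classical
  obtain ⟨R, hR2, hRx, hlog⟩ := exists_sieve_level hx
  have hs := card_sifted_linear_le (B := D) (by omega) (c := D) dvd_rfl a (2 * x / D) hR2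
  set T := (Icc 1 (2 * x / D)).filter fun j : ℕ ↦
    ∀ p : ℕ, p.Prime → p ≤ R → ¬ p ∣ D → ¬ (p : ℤ) ∣ D * (j : ℕ) - a with hT
  have hRpos : 0 < Real.log R := Real.log_pos (by exact_mod_cast hR2)
  have hx1 : (1 : ℝ) < x := by exact_mod_cast lt_of_lt_of_le (by norm_num) hx
  have hxpos : 0 < Real.log x := Real.log_pos hx1
  have hD0 : (0 : ℝ) < D := by exact_mod_cast hD
  -- Write p = Dm - a with m ≤ 2x/D. A prime r ≤ R dividing p would equal p, against p^2 > x ≥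
  -- R^100, so m survives the sieve.
  have hcard : #{p ∈ largePrimes x | (D : ℤ) ∣ ((p : ℕ) : ℤ) + a} ≤ #T := by
    have hex : ∀ p ∈ (largePrimes x).filter (fun p : ℕ ↦ (D : ℤ) ∣ p + a),
        ∃ m ∈ T, (p : ℤ) = D * m - a := by
      intro p hp
      rw [mem_filter] at hp
      obtain ⟨N, hN, hN1, hN2⟩ := exists_shift_eq ha hp.1
      have hDN : D ∣ N := by
        have := hp.2
        rw [← hN] at this
        exact_mod_cast this
      obtain ⟨m, rfl⟩ := hDN
      have hpm : (p : ℤ) = D * m - a := by push_cast at hN; linarith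
      refine ⟨m, ?_, hpm⟩
      have hm0 : 0 < m := Nat.pos_of_ne_zero (by rintro rfl; simp at hN1)
      rw [hT, mem_filter, mem_Icc]
      refine ⟨⟨hm0, (Nat.le_div_iff_mul_le (by omega)).2 (by linarith)⟩, ?_⟩
      intro r hr hrR _ hrd
      rw [← hpm, Int.natCast_dvd_natCast] at hrd
      obtain ⟨-, hpp, hp2⟩ := mem_largePrimes.1 hp.1
      rw [Nat.prime_dvd_prime_iff_eq hr hpp] at hrd
      subst hrd
      have : r ^ 2 ≤ R ^ 100 := (Nat.pow_le_pow_left hrR 2).trans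
        (Nat.pow_le_pow_right (by omega) (by norm_num))
      omega
    choose! g hg1 hg2 using hex
    refine card_le_card_of_injOn g (fun p hp ↦ hg1 p hp) ?_
    intro p hp p' hp' h
    have e1 := hg2 p hp
    have e2 := hg2 p' hp'
    rw [h] at e1
    exact_mod_cast e1.trans e2.symm
  have hpow : (R : ℝ) ^ 6 ≤ (x : ℝ) ^ (1 / 10 : ℝ) := by
    refine (pow_le_rpow_of_pow_le hRx 6).trans ?_
    exact Real.rpow_le_rpow_of_exponent_le hx1.le (by norm_num)
  have hdiv : ((2 * x / D : ℕ) : ℝ) ≤ 2 * x / D := by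
    refine Nat.cast_div_le.trans ?_
    push_cast; rfl
  have hsD := sumInvDivisors_nonneg D
  calc (#{p ∈ largePrimes x | (D : ℤ) ∣ ((p : ℕ) : ℤ) + a} : ℝ) ≤ #T := by exact_mod_cast hcard
    _ ≤ _ := hs
    _ ≤ 2 * sumInvDivisors D * (2 * x / D) / (Real.log x / 200) + (x : ℝ) ^ (1 / 10 : ℝ) := by
        gcongr
        linarith
    _ = _ := by field_simp; ring

/-- Few shifted primes are divisible by the square of a large prime power. -/
theorem card_largePrimes_sq_dvd_le {a : ℤ} {x w : ℕ} (hx : 2 ^ 100 ≤ x) (ha : a ^ 2 ≤ x)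
    (hw : 1 ≤ w) [DecidablePred fun p : ℕ ↦ ∃ m : ℕ, w < m ∧ IsPrimePow m ∧ ((m ^ 2 : ℕ) : ℤ) ∣ p + a] :
    (#{p ∈ largePrimes x | ∃ m : ℕ, w < m ∧ IsPrimePow m ∧ ((m ^ 2 : ℕ) : ℤ) ∣ ((p : ℕ) : ℤ) + a} : ℝ) ≤
      1600 * (x / Real.log x) / w + 2 * (x : ℝ) ^ (3 / 4 : ℝ) := by
  classical
  have hx1 : (1 : ℝ) < x := by exact_mod_cast lt_of_lt_of_le (by norm_num) hx
  have hxpos : 0 < Real.log x := Real.log_pos hx1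
  set I := (Ioc w (Nat.sqrt (2 * x))).filter IsPrimePow with hI
  have h1 : (largePrimes x).filter (fun p : ℕ ↦ ∃ m : ℕ, w < m ∧ IsPrimePow m ∧ ((m ^ 2 : ℕ) : ℤ) ∣ p + a)
      ⊆ (largePrimes x).filter (fun p : ℕ ↦ ∃ m ∈ I, ((m ^ 2 : ℕ) : ℤ) ∣ p + a) := by
    intro p hp
    rw [mem_filter] at hp ⊢
    obtain ⟨hp, m, hm1, hm2, hm3⟩ := hp
    refine ⟨hp, m, ?_, hm3⟩
    obtain ⟨N, hN, hN1, hN2⟩ := exists_shift_eq ha hp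
    rw [← hN, Int.natCast_dvd_natCast] at hm3
    have := Nat.le_of_dvd hN1 hm3
    rw [hI, mem_filter, mem_Ioc]
    exact ⟨⟨hm1, Nat.le_sqrt'.2 (by omega)⟩, hm2⟩
  have h2 := card_filter_exists_le (largePrimes x) I (fun m p ↦ ((m ^ 2 : ℕ) : ℤ) ∣ p + a)
    (fun m ↦ 1600 * (x / Real.log x) * ((m : ℝ) ^ 2)⁻¹ + (x : ℝ) ^ (1 / 10 : ℝ)) (by
      intro m hm
      rw [hI, mem_filter, mem_Ioc] at hm
      have hm0 : 1 ≤ m ^ 2 := Nat.one_le_pow _ _ (by omega)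
      refine (card_largePrimes_dvd_le hx ha hm0).trans ?_
      -- Restricting m to prime powers keeps the arithmetic factor bounded.
      have hs : sumInvDivisors (m ^ 2) ≤ 2 := by
        obtain ⟨q, k, hq, -, rfl⟩ := (isPrimePow_nat_iff m).1 hm.2
        rw [← pow_mul]
        exact sumInvDivisors_prime_pow_le hq
      have hm0' : (0 : ℝ) < m := by exact_mod_cast (by omega : 0 < m)
      gcongr
      calc 800 * sumInvDivisors (m ^ 2) * x / (((m ^ 2 : ℕ) : ℝ) * Real.log x)
          ≤ 800 * 2 * x / (((m ^ 2 : ℕ) : ℝ) * Real.log x) := by gcongr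
        _ = _ := by push_cast; field_simp; ring)
  have h3 : (#I : ℝ) ≤ 2 * (x : ℝ) ^ (1 / 2 : ℝ) := by
    have : #I ≤ Nat.sqrt (2 * x) := by
      refine (card_filter_le _ _).trans ?_
      simp
    calc (#I : ℝ) ≤ Nat.sqrt (2 * x) := by exact_mod_cast this
      _ ≤ √((2 * x : ℕ) : ℝ) := Real.nat_sqrt_le_real_sqrt
      _ ≤ √(2 ^ 2 * x) := by
          apply Real.sqrt_le_sqrt; push_cast; linarith
      _ = _ := by
          rw [Real.sqrt_mul (by norm_num), Real.sqrt_sq (by norm_num), Real.sqrt_eq_rpow]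
  have h4 : ∑ m ∈ I, ((m : ℝ) ^ 2)⁻¹ ≤ (w : ℝ)⁻¹ :=
    (sum_le_sum_of_subset_of_nonneg (filter_subset _ _) fun _ _ _ ↦ by positivity).trans
      (sum_Ioc_inv_sq_le w _ hw)
  calc _ ≤ _ := by exact_mod_cast card_le_card h1
    _ ≤ _ := h2
    _ = 1600 * (x / Real.log x) * ∑ m ∈ I, ((m : ℝ) ^ 2)⁻¹ + #I * (x : ℝ) ^ (1 / 10 : ℝ) := by
        rw [sum_add_distrib, ← mul_sum, sum_const, nsmul_eq_mul]
    _ ≤ 1600 * (x / Real.log x) * (w : ℝ)⁻¹ +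
        2 * (x : ℝ) ^ (1 / 2 : ℝ) * (x : ℝ) ^ (1 / 10 : ℝ) := by gcongr
    _ ≤ _ := by
        rw [mul_assoc 2, ← Real.rpow_add (by linarith), ← div_eq_mul_inv]
        gcongr
        · exact hx1.le
        · norm_num

/-- Few shifted primes have a prime factor `q` with `q ≡ -1` modulo a very large prime factor. -/
theorem card_largePrimes_exists_very_large_le {a : ℤ} {x L : ℕ} (hx : 1 ≤ x) (ha : a ^ 2 ≤ x)
    (hL : 1 ≤ L) [DecidablePred fun p : ℕ ↦ ∃ l q : ℕ, L < l ∧ l ∣ q + 1 ∧ 1 ≤ q ∧ ((l * q : ℕ) : ℤ) ∣ p + a] :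
    (#{p ∈ largePrimes x | ∃ l q : ℕ, L < l ∧ l ∣ q + 1 ∧ 1 ≤ q ∧ ((l * q : ℕ) : ℤ) ∣ ((p : ℕ) : ℤ) + a} : ℝ) ≤
      4 * x * (1 + Real.log (2 * x)) / L := by
  classical
  -- The pairs are (l, j) with q = lj - 1.
  set I := Ioc L (2 * x) ×ˢ Icc 1 (2 * x) with hI
  have h1 : (largePrimes x).filter
      (fun p : ℕ ↦ ∃ l q : ℕ, L < l ∧ l ∣ q + 1 ∧ 1 ≤ q ∧ ((l * q : ℕ) : ℤ) ∣ p + a)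
      ⊆ (largePrimes x).filter (fun p : ℕ ↦ ∃ i ∈ I, ((i.1 * (i.1 * i.2 - 1) : ℕ) : ℤ) ∣ p + a) := by
    intro p hp
    rw [mem_filter] at hp ⊢
    obtain ⟨hp, l, q, hl, ⟨j, hj⟩, hq, hd⟩ := hp
    refine ⟨hp, (l, j), ?_, ?_⟩
    · obtain ⟨N, hN, hN1, hN2⟩ := exists_shift_eq ha hp
      rw [← hN, Int.natCast_dvd_natCast] at hd
      have h2 := Nat.le_of_dvd hN1 hd
      have hj0 : 0 < j := Nat.pos_of_ne_zero (by rintro rfl; simp at hj)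
      have h3 : l ≤ l * q := Nat.le_mul_of_pos_right _ hq
      have h4 : q + 1 ≤ l * q := by nlinarith
      have h5 : j ≤ l * j := Nat.le_mul_of_pos_left _ (by omega)
      rw [hI, mem_product, mem_Ioc, mem_Icc]
      exact ⟨⟨hl, by simp only; omega⟩, hj0, by simp only; omega⟩
    · have : l * j - 1 = q := by omega
      simpa [this] using hd
  have h2 := card_filter_exists_le (largePrimes x) I
    (fun i p ↦ ((i.1 * (i.1 * i.2 - 1) : ℕ) : ℤ) ∣ p + a)
    (fun i ↦ 4 * x * (((i.1 : ℝ) ^ 2)⁻¹ * (i.2 : ℝ)⁻¹)) (by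
      rintro ⟨l, j⟩ hi
      rw [hI, mem_product, mem_Ioc, mem_Icc] at hi
      simp only at hi ⊢
      obtain ⟨⟨hl, -⟩, hj, -⟩ := hi
      set D := l * (l * j - 1) with hD
      have hlj : 2 ≤ l * j := by nlinarith
      have hD0 : 0 < D := Nat.mul_pos (by omega) (by omega)
      -- The primality of p is discarded here: only multiples of D up to 2x are counted, and D ≥ l^2
      -- j / 2 makes the sum over l > L converge to O(1/L).
      have hcard : #{p ∈ largePrimes x | (D : ℤ) ∣ ((p : ℕ) : ℤ) + a} ≤ 2 * x / D := by
        rw [← Nat.Ioc_filter_dvd_card_eq_div]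
        have hex : ∀ p ∈ (largePrimes x).filter (fun p : ℕ ↦ (D : ℤ) ∣ (p : ℤ) + a),
            ∃ N ∈ (Ioc 0 (2 * x)).filter (D ∣ ·), (N : ℤ) = p + a := by
          intro p hp
          rw [mem_filter] at hp
          obtain ⟨N, hN, hN1, hN2⟩ := exists_shift_eq ha hp.1
          refine ⟨N, ?_, hN⟩
          have := hp.2
          rw [← hN, Int.natCast_dvd_natCast] at this
          rw [mem_filter, mem_Ioc]
          exact ⟨⟨hN1, hN2⟩, this⟩
        choose! g hg1 hg2 using hex
        refine card_le_card_of_injOn g (fun p hp ↦ hg1 p hp) ?_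
        intro p hp p' hp' h
        have e1 := hg2 p hp
        have e2 := hg2 p' hp'
        rw [h] at e1
        omega
      have hl0 : (0 : ℝ) < l := by exact_mod_cast (by omega : 0 < l)
      have hj0 : (0 : ℝ) < j := by exact_mod_cast hj
      have hDr : (l : ℝ) ^ 2 * j / 2 ≤ D := by
        rw [hD]; push_cast [Nat.cast_sub (by omega : 1 ≤ l * j)]
        have : (2 : ℝ) ≤ l * j := by exact_mod_cast hlj
        nlinarith
      calc _ ≤ ((2 * x / D : ℕ) : ℝ) := by exact_mod_cast hcard
        _ ≤ ((2 * x : ℕ) : ℝ) / D := Nat.cast_div_le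
        _ ≤ ((2 * x : ℕ) : ℝ) / ((l : ℝ) ^ 2 * j / 2) := by gcongr
        _ = _ := by push_cast; field_simp; ring)
  have hL0 : (0 : ℝ) < L := by exact_mod_cast hL
  have hx0 : (1 : ℝ) ≤ x := by exact_mod_cast hx
  have hlog : 0 ≤ Real.log (2 * x) := Real.log_nonneg (by linarith)
  calc _ ≤ _ := by exact_mod_cast card_le_card h1
    _ ≤ _ := h2
    _ = 4 * x * ((∑ l ∈ Ioc L (2 * x), ((l : ℝ) ^ 2)⁻¹) * ∑ j ∈ Icc 1 (2 * x), (j : ℝ)⁻¹) := by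
        rw [← mul_sum, hI, sum_product, sum_mul_sum]
    _ ≤ 4 * x * ((L : ℝ)⁻¹ * (1 + Real.log (2 * x))) := by
        have := sum_Icc_inv_le (2 * x)
        push_cast at this
        gcongr
        exact sum_Ioc_inv_sq_le L _ hL
    _ = _ := by field_simp

open ArithmeticFunction in
/-- The first moment of the logarithm of the smooth part of a shifted prime. -/
theorem sum_largePrimes_vonMangoldt_le {a : ℤ} {x z : ℕ} (hx : 2 ^ 100 ≤ x) (ha : a ^ 2 ≤ x) :
    ∑ p ∈ largePrimes x, ∑ d ∈ Icc 1 z with ((d : ℕ) : ℤ) ∣ (p : ℤ) + a, vonMangoldt d ≤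
      1600 * (x / Real.log x) * (Real.log z + 6) + z * Real.log z * (x : ℝ) ^ (1 / 10 : ℝ) := by
  have hx1 : (1 : ℝ) < x := by exact_mod_cast lt_of_lt_of_le (by norm_num) hx
  have hxpos : 0 < Real.log x := Real.log_pos hx1
  calc ∑ p ∈ largePrimes x, ∑ d ∈ Icc 1 z with ((d : ℕ) : ℤ) ∣ (p : ℤ) + a, vonMangoldt d
      = ∑ d ∈ Icc 1 z, vonMangoldt d * #{p ∈ largePrimes x | (d : ℤ) ∣ ((p : ℕ) : ℤ) + a} := by
        simp_rw [sum_filter]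
        rw [sum_comm]
        refine sum_congr rfl fun d _ ↦ ?_
        rw [← sum_filter, sum_const, nsmul_eq_mul, mul_comm]
    _ ≤ ∑ d ∈ Icc 1 z, (1600 * (x / Real.log x) * (vonMangoldt d / d) +
          Real.log z * (x : ℝ) ^ (1 / 10 : ℝ)) := by
        refine sum_le_sum fun d hd ↦ ?_
        rw [mem_Icc] at hd
        have hd0 : (0 : ℝ) < d := by exact_mod_cast hd.1
        have hle : vonMangoldt d ≤ Real.log z :=
          vonMangoldt_le_log.trans (Real.log_le_log hd0 (by exact_mod_cast hd.2))
        by_cases hpp : IsPrimePow d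
        · have hs : sumInvDivisors d ≤ 2 := by
            obtain ⟨q, k, hq, -, rfl⟩ := (isPrimePow_nat_iff d).1 hpp
            exact sumInvDivisors_prime_pow_le hq
          have h0 : 0 ≤ vonMangoldt d := vonMangoldt_nonneg
          calc _ ≤ vonMangoldt d * (800 * sumInvDivisors d * x / (d * Real.log x) +
                (x : ℝ) ^ (1 / 10 : ℝ)) :=
                mul_le_mul_of_nonneg_left (card_largePrimes_dvd_le hx ha hd.1) h0
            _ ≤ vonMangoldt d * (800 * 2 * x / (d * Real.log x) + (x : ℝ) ^ (1 / 10 : ℝ)) := by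
                gcongr
            _ = 1600 * (x / Real.log x) * (vonMangoldt d / d) +
                vonMangoldt d * (x : ℝ) ^ (1 / 10 : ℝ) := by field_simp; ring
            _ ≤ _ := by gcongr
        · rw [vonMangoldt_eq_zero_iff.2 hpp]
          have : 0 ≤ Real.log z := Real.log_natCast_nonneg z
          simp only [zero_mul, zero_div, mul_zero, zero_add]
          positivity
    _ = 1600 * (x / Real.log x) * ∑ d ∈ Icc 1 z, vonMangoldt d / d +
        z * (Real.log z * (x : ℝ) ^ (1 / 10 : ℝ)) := by
        rw [sum_add_distrib, ← mul_sum, sum_const, nsmul_eq_mul]; simp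
    _ ≤ _ := by
        have := sum_vonMangoldt_div_le z
        rw [← mul_assoc (z : ℝ)]
        gcongr

end

/-! ### Primes congruent to -1 modulo l, and the range of small q. -/

section
open Finset

/-- This is the bound for shifted primes with shift 1. The primes up to √u and the sieve error are
each at most √u, and l ≤ u^(1/4) with log u ≤ 4u^(1/4) gives √u ≤ 4u/(l log u); hence 1608 = 1600 +
2·4. -/
theorem card_primes_dvd_add_one_le {u l : ℕ} (hu : 2 ^ 100 ≤ u) (hl : l.Prime) (hlu : l ^ 4 ≤ u) :
    (#{q ∈ Icc 1 u | q.Prime ∧ l ∣ q + 1} : ℝ) ≤ 1608 * u / (l * Real.log u) := by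
  have hu1 : (1 : ℝ) < u := by exact_mod_cast lt_of_lt_of_le (by norm_num) hu
  have hlog : 0 < Real.log u := Real.log_pos hu1
  have hl0 : (0 : ℝ) < l := by exact_mod_cast hl.pos
  have h1 := card_largePrimes_dvd_le (a := 1) (D := l) hu
    (by simp only [one_pow]; exact_mod_cast hu1.le) hl.one_le
  have hsub : (Icc 1 u).filter (fun q ↦ q.Prime ∧ l ∣ q + 1) ⊆
      (largePrimes u).filter (fun p : ℕ ↦ (l : ℤ) ∣ p + 1) ∪ Icc 1 (Nat.sqrt u) := by
    intro q hq
    simp only [mem_filter, mem_union, mem_Icc, mem_largePrimes] at hq ⊢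
    by_cases h : u < q ^ 2
    · exact Or.inl ⟨⟨hq.1.2, hq.2.1, h⟩, by exact_mod_cast hq.2.2⟩
    · exact Or.inr ⟨hq.1.1, Nat.le_sqrt'.2 (not_lt.1 h)⟩
  have h2 : (#{q ∈ Icc 1 u | q.Prime ∧ l ∣ q + 1} : ℝ) ≤
      #{p ∈ largePrimes u | (l : ℤ) ∣ ((p : ℕ) : ℤ) + 1} + Nat.sqrt u := by
    have := (card_le_card hsub).trans (card_union_le _ _)
    rw [Nat.card_Icc, Nat.add_sub_cancel] at this
    exact_mod_cast this
  have h3 : (Nat.sqrt u : ℝ) ≤ (u : ℝ) ^ (1 / 2 : ℝ) := by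
    rw [← Real.sqrt_eq_rpow]; exact Real.nat_sqrt_le_real_sqrt
  have h4 : (u : ℝ) ^ (1 / 10 : ℝ) ≤ (u : ℝ) ^ (1 / 2 : ℝ) :=
    Real.rpow_le_rpow_of_exponent_le hu1.le (by norm_num)
  have h5 : (l : ℝ) ≤ (u : ℝ) ^ (1 / 4 : ℝ) := by
    have : ((l : ℝ) ^ 4) ≤ u := by exact_mod_cast hlu
    calc (l : ℝ) = ((l : ℝ) ^ 4) ^ (1 / 4 : ℝ) := by
          rw [← Real.rpow_natCast, ← Real.rpow_mul hl0.le]; norm_num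
      _ ≤ _ := by gcongr
  have h6 : Real.log u ≤ 4 * (u : ℝ) ^ (1 / 4 : ℝ) := by
    have := Real.log_le_rpow_div (by linarith : (0 : ℝ) ≤ u) (by norm_num : (0 : ℝ) < 1 / 4)
    linarith
  have h7 : (u : ℝ) ^ (1 / 2 : ℝ) ≤ 4 * u / (l * Real.log u) := by
    rw [le_div_iff₀ (by positivity)]
    calc (u : ℝ) ^ (1 / 2 : ℝ) * (l * Real.log u)
        ≤ (u : ℝ) ^ (1 / 2 : ℝ) * ((u : ℝ) ^ (1 / 4 : ℝ) * (4 * (u : ℝ) ^ (1 / 4 : ℝ))) := by gcongr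
      _ = 4 * ((u : ℝ) ^ (1 / 2 : ℝ) * ((u : ℝ) ^ (1 / 4 : ℝ) * (u : ℝ) ^ (1 / 4 : ℝ))) := by ring
      _ = _ := by
        rw [← Real.rpow_add (by linarith), ← Real.rpow_add (by linarith)]; norm_num
  have hs : sumInvDivisors l ≤ 2 := by
    simpa using sumInvDivisors_prime_pow_le (k := 1) hl
  have h8 : 800 * sumInvDivisors l * u / (l * Real.log u) ≤ 1600 * u / (l * Real.log u) := by
    gcongr; linarith
  have h9 : 1608 * u / (l * Real.log u) = 1600 * u / (l * Real.log u) +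
      2 * (4 * u / (l * Real.log u)) := by ring
  rw [h9]
  linarith

theorem sum_inv_dvd_add_one_le (V : ℕ) {l : ℕ} (hl : 1 ≤ l) :
    ∑ q ∈ Icc 1 V with l ∣ q + 1, (q : ℝ)⁻¹ ≤ 2 * ((l : ℝ)⁻¹ * (1 + Real.log (V + 1))) := by
  have h := sum_Icc_dvd_inv_le l (V + 1) hl
  push_cast at h
  calc ∑ q ∈ Icc 1 V with l ∣ q + 1, (q : ℝ)⁻¹
      ≤ ∑ q ∈ Icc 1 V with l ∣ q + 1, 2 * ((q + 1 : ℕ) : ℝ)⁻¹ := by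
        refine sum_le_sum fun q hq ↦ ?_
        have hq1 : (1 : ℝ) ≤ q := by exact_mod_cast (mem_Icc.1 (mem_filter.1 hq).1).1
        rw [← div_eq_mul_inv, inv_eq_one_div, div_le_div_iff₀ (by linarith) (by positivity)]
        push_cast; linarith
    _ = 2 * ∑ n ∈ ((Icc 1 V).filter fun q : ℕ ↦ l ∣ q + 1).image (fun q : ℕ ↦ q + 1),
          ((n : ℕ) : ℝ)⁻¹ := by
        rw [← mul_sum, sum_image fun _ _ _ _ h ↦ Nat.succ_injective h]
    _ ≤ 2 * ∑ n ∈ Icc 1 (V + 1) with l ∣ n, (n : ℝ)⁻¹ := by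
        refine mul_le_mul_of_nonneg_left
          (sum_le_sum_of_subset_of_nonneg ?_ fun _ _ _ ↦ by positivity) zero_le_two
        intro n hn
        simp only [mem_image, mem_filter, mem_Icc] at hn ⊢
        obtain ⟨q, ⟨⟨h1, h2⟩, h3⟩, rfl⟩ := hn
        exact ⟨⟨by omega, by omega⟩, h3⟩
    _ ≤ _ := by gcongr

/-- Up to V = 2^100 l^4 all integers q ≡ -1 (mod l) are counted, costing O((1 + log l)/l). Beyond V,
the prime bound on [2^i, 2^(i+1)) contributes O(1/(l(i + 1))), and the harmonic sum over i yields a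
double logarithm of x rather than a single one. -/
theorem sum_inv_primes_dvd_add_one_le {l : ℕ} (hl : l.Prime) (x : ℕ) :
    ∑ q ∈ Icc 1 x with q.Prime ∧ l ∣ q + 1, (q : ℝ)⁻¹ ≤
      10000 * (1 + Real.log l + Real.log (Nat.log 2 x + 1)) / l := by
  have hl0 : (0 : ℝ) < l := by exact_mod_cast hl.pos
  have hl1 : (1 : ℝ) ≤ l := by exact_mod_cast hl.one_le
  have hlogl : 0 ≤ Real.log l := Real.log_nonneg hl1
  have hlog2 := Real.log_two_gt_d9
  have hlog2' := Real.log_two_lt_d9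
  set V := 2 ^ 100 * l ^ 4 with hV
  set n := Nat.log 2 x with hn
  have hlogn : 0 ≤ Real.log (n + 1) := Real.log_nonneg (by linarith [Nat.cast_nonneg (α := ℝ) n])
  have hsmall : ∑ q ∈ Icc 1 V with l ∣ q + 1, (q : ℝ)⁻¹ ≤ (200 + 8 * Real.log l) / l := by
    refine (sum_inv_dvd_add_one_le V hl.one_le).trans ?_
    have h1 : Real.log ((V : ℝ) + 1) ≤ 99 + 4 * Real.log l := by
      have : (V : ℝ) + 1 ≤ 2 ^ 101 * (l : ℝ) ^ 4 := by
        rw [hV]; push_cast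
        have : (1 : ℝ) ≤ (l : ℝ) ^ 4 := one_le_pow₀ hl1
        nlinarith
      refine (Real.log_le_log (by positivity) this).trans ?_
      rw [Real.log_mul (by positivity) (by positivity), Real.log_pow, Real.log_pow]
      push_cast
      linarith
    calc _ ≤ 2 * ((l : ℝ)⁻¹ * (1 + (99 + 4 * Real.log l))) := by gcongr
      _ = _ := by field_simp; ring
  set T := (Icc 1 x).filter fun q ↦ (q.Prime ∧ l ∣ q + 1) ∧ V < q with hT
  have hlarge : ∑ q ∈ T, (q : ℝ)⁻¹ ≤ 5000 * (1 + Real.log (n + 1)) / l := by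
    have hmap : ∀ q ∈ T, Nat.log 2 q ∈ range (n + 1) := by
      intro q hq
      simp only [hT, mem_filter, mem_Icc] at hq
      rw [mem_range, Nat.lt_succ_iff]
      exact Nat.log_mono_right hq.1.2
    rw [← sum_fiberwise_of_maps_to hmap]
    have hfib : ∀ i ∈ range (n + 1), ∑ q ∈ T with Nat.log 2 q = i, (q : ℝ)⁻¹ ≤
        5000 / l * ((i + 1 : ℕ) : ℝ)⁻¹ := by
      intro i _
      rcases (T.filter fun q ↦ Nat.log 2 q = i).eq_empty_or_nonempty with he | ⟨q₀, hq₀⟩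
      · rw [he, sum_empty]; positivity
      have hrange : ∀ q ∈ T.filter (fun q ↦ Nat.log 2 q = i), 2 ^ i ≤ q ∧ q < 2 ^ (i + 1) := by
        intro q hq
        simp only [hT, mem_filter, mem_Icc] at hq
        rw [← hq.2]
        exact ⟨Nat.pow_log_le_self 2 (by omega), Nat.lt_pow_succ_log_self one_lt_two q⟩
      have hVu : V < 2 ^ (i + 1) := by
        have h1 := (hrange q₀ hq₀).2
        simp only [hT, mem_filter] at hq₀
        omega
      have hl4 : 1 ≤ l ^ 4 := Nat.one_le_pow _ _ hl.pos
      have hcard := card_primes_dvd_add_one_le (u := 2 ^ (i + 1)) (l := l)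
        (le_trans (by rw [hV]; exact Nat.le_mul_of_pos_right _ hl4) hVu.le) hl
        (le_trans (by rw [hV]; exact Nat.le_mul_of_pos_left _ (by positivity)) hVu.le)
      have hsub : T.filter (fun q ↦ Nat.log 2 q = i) ⊆
          (Icc 1 (2 ^ (i + 1))).filter fun q ↦ q.Prime ∧ l ∣ q + 1 := by
        intro q hq
        have h1 := hrange q hq
        simp only [hT, mem_filter, mem_Icc] at hq ⊢
        exact ⟨⟨hq.1.1.1, h1.2.le⟩, hq.1.2.1⟩
      have hlogu : Real.log ((2 ^ (i + 1) : ℕ) : ℝ) = (i + 1) * Real.log 2 := by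
        push_cast; rw [Real.log_pow]; push_cast; ring
      rw [hlogu] at hcard
      calc ∑ q ∈ T with Nat.log 2 q = i, (q : ℝ)⁻¹
          ≤ ∑ q ∈ T with Nat.log 2 q = i, ((2 : ℝ) ^ i)⁻¹ := by
            refine sum_le_sum fun q hq ↦ ?_
            have := (hrange q hq).1
            gcongr
            exact_mod_cast this
        _ = #(T.filter fun q ↦ Nat.log 2 q = i) * ((2 : ℝ) ^ i)⁻¹ := by simp
        _ ≤ (1608 * ((2 ^ (i + 1) : ℕ) : ℝ) / (l * ((i + 1) * Real.log 2))) * ((2 : ℝ) ^ i)⁻¹ := by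
            gcongr
            exact le_trans (by exact_mod_cast card_le_card hsub) hcard
        _ = 3216 / Real.log 2 / l * ((i + 1 : ℕ) : ℝ)⁻¹ := by
            push_cast; rw [pow_succ]; field_simp; ring
        _ ≤ 5000 / l * ((i + 1 : ℕ) : ℝ)⁻¹ := by
            gcongr
            rw [div_le_iff₀ (by linarith)]
            linarith
    refine (sum_le_sum hfib).trans ?_
    rw [← mul_sum]
    have h1 : ∑ i ∈ range (n + 1), ((i + 1 : ℕ) : ℝ)⁻¹ = ∑ k ∈ Icc 1 (n + 1), (k : ℝ)⁻¹ := by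
      rw [range_eq_Ico, sum_Ico_add' (fun k : ℕ ↦ (k : ℝ)⁻¹) 0 (n + 1) 1]
      rfl
    have h2 := sum_Icc_inv_le (n + 1)
    push_cast at h2
    rw [h1]
    calc _ ≤ 5000 / (l : ℝ) * (1 + Real.log (n + 1)) := by gcongr
      _ = _ := by ring
  have hsub : (Icc 1 x).filter (fun q ↦ q.Prime ∧ l ∣ q + 1) ⊆
      (Icc 1 V).filter (fun q ↦ l ∣ q + 1) ∪ T := by
    intro q hq
    simp only [hT, mem_union, mem_filter, mem_Icc] at hq ⊢
    rcases le_or_gt q V with h | h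
    · exact Or.inl ⟨⟨hq.1.1, h⟩, hq.2.2⟩
    · exact Or.inr ⟨hq.1, hq.2, h⟩
  calc _ ≤ ∑ q ∈ (Icc 1 V).filter (fun q ↦ l ∣ q + 1) ∪ T, (q : ℝ)⁻¹ :=
        sum_le_sum_of_subset_of_nonneg hsub fun _ _ _ ↦ by positivity
    _ ≤ ∑ q ∈ (Icc 1 V).filter (fun q ↦ l ∣ q + 1), (q : ℝ)⁻¹ + ∑ q ∈ T, (q : ℝ)⁻¹ := by
        rw [← sum_union_inter]
        exact le_add_of_nonneg_right (sum_nonneg fun _ _ ↦ by positivity)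
    _ ≤ (200 + 8 * Real.log l) / l + 5000 * (1 + Real.log (n + 1)) / l := add_le_add hsmall hlarge
    _ ≤ _ := by
        rw [← add_div]
        gcongr
        linarith

/-- Few shifted primes have prime factors `l` and `q` with `q ≡ -1 (mod l)`, where `l` is of
moderate size and `q` is small. -/
theorem card_largePrimes_exists_small_le {a : ℤ} {x z L Q : ℕ} (hx : 2 ^ 100 ≤ x)
    (ha : a ^ 2 ≤ x) (hz : 1 ≤ z)
    [DecidablePred fun p : ℕ ↦ ∃ l q : ℕ, z < l ∧ l ≤ L ∧ q ≤ Q ∧ l.Prime ∧ q.Prime ∧ l ∣ q + 1 ∧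
      ((l * q : ℕ) : ℤ) ∣ p + a] :
    (#{p ∈ largePrimes x | ∃ l q : ℕ, z < l ∧ l ≤ L ∧ q ≤ Q ∧ l.Prime ∧ q.Prime ∧ l ∣ q + 1 ∧
      ((l * q : ℕ) : ℤ) ∣ ((p : ℕ) : ℤ) + a} : ℝ) ≤
      32000000 * (x / Real.log x) * (1 + Real.log L + Real.log (Nat.log 2 Q + 1)) / z +
        L * Q * (x : ℝ) ^ (1 / 10 : ℝ) := by
  classical
  have hx1 : (1 : ℝ) < x := by exact_mod_cast lt_of_lt_of_le (by norm_num) hx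
  have hxpos : 0 < Real.log x := Real.log_pos hx1
  set I := ((Ioc z L).filter Nat.Prime).sigma fun l ↦
    (Icc 1 Q).filter fun q ↦ q.Prime ∧ l ∣ q + 1 with hI
  have h1 : (largePrimes x).filter (fun p : ℕ ↦ ∃ l q : ℕ, z < l ∧ l ≤ L ∧ q ≤ Q ∧ l.Prime ∧
      q.Prime ∧ l ∣ q + 1 ∧ ((l * q : ℕ) : ℤ) ∣ p + a) ⊆
      (largePrimes x).filter (fun p : ℕ ↦ ∃ i ∈ I, ((i.1 * i.2 : ℕ) : ℤ) ∣ p + a) := by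
    intro p hp
    rw [mem_filter] at hp ⊢
    obtain ⟨hp, l, q, h1, h2, h3, h4, h5, h6, h7⟩ := hp
    refine ⟨hp, ⟨l, q⟩, ?_, h7⟩
    simp only [hI, mem_sigma, mem_filter, mem_Ioc, mem_Icc]
    exact ⟨⟨⟨h1, h2⟩, h4⟩, ⟨h5.one_le, h3⟩, h5, h6⟩
  have h2 := card_filter_exists_le (largePrimes x) I (fun i p ↦ ((i.1 * i.2 : ℕ) : ℤ) ∣ p + a)
    (fun i ↦ 3200 * (x / Real.log x) * ((i.1 : ℝ)⁻¹ * (i.2 : ℝ)⁻¹) + (x : ℝ) ^ (1 / 10 : ℝ)) (by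
      rintro ⟨l, q⟩ hi
      simp only [hI, mem_sigma, mem_filter, mem_Ioc, mem_Icc] at hi ⊢
      obtain ⟨⟨-, hl⟩, -, hq, -⟩ := hi
      refine (card_largePrimes_dvd_le hx ha (Nat.mul_pos hl.pos hq.pos)).trans ?_
      have hs1 : sumInvDivisors l ≤ 2 := by simpa using sumInvDivisors_prime_pow_le (k := 1) hl
      have hs2 : sumInvDivisors q ≤ 2 := by simpa using sumInvDivisors_prime_pow_le (k := 1) hq
      have hs : sumInvDivisors (l * q) ≤ 4 := by
        refine (sumInvDivisors_mul_le l q).trans ?_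
        have := sumInvDivisors_nonneg l
        have := sumInvDivisors_nonneg q
        nlinarith
      have hl0 : (0 : ℝ) < l := by exact_mod_cast hl.pos
      have hq0 : (0 : ℝ) < q := by exact_mod_cast hq.pos
      gcongr
      calc 800 * sumInvDivisors (l * q) * x / (((l * q : ℕ) : ℝ) * Real.log x)
          ≤ 800 * 4 * x / (((l * q : ℕ) : ℝ) * Real.log x) := by gcongr
        _ = _ := by push_cast; field_simp; ring)
  have hcard : (#I : ℝ) ≤ L * Q := by
    have : #I ≤ L * Q := by
      rw [hI, card_sigma]
      calc _ ≤ ∑ l ∈ (Ioc z L).filter Nat.Prime, Q :=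
            sum_le_sum fun l _ ↦ (card_filter_le _ _).trans (by simp)
        _ ≤ L * Q := by
            rw [sum_const, smul_eq_mul]
            exact Nat.mul_le_mul_right _ ((card_filter_le _ _).trans (by simp))
    exact_mod_cast this
  set Y := 1 + Real.log L + Real.log (Nat.log 2 Q + 1) with hY
  have hY0 : 0 ≤ Y := by
    have h3 : 0 ≤ Real.log L := Real.log_natCast_nonneg L
    have h4 : 0 ≤ Real.log (Nat.log 2 Q + 1) :=
      Real.log_nonneg (by linarith [Nat.cast_nonneg (α := ℝ) (Nat.log 2 Q)])
    linarith
  -- Summing over q first gains a second factor 1/l, and the tail of the sum of 1/l^2 gives 1/z.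
  have hsum : ∑ i ∈ I, (i.1 : ℝ)⁻¹ * (i.2 : ℝ)⁻¹ ≤ 10000 * Y / z := by
    rw [hI, sum_sigma]
    calc _ ≤ ∑ l ∈ (Ioc z L).filter Nat.Prime, 10000 * Y * ((l : ℝ) ^ 2)⁻¹ := by
          refine sum_le_sum fun l hl ↦ ?_
          simp only [mem_filter, mem_Ioc] at hl
          dsimp only
          rw [← mul_sum]
          have hl0 : (0 : ℝ) < l := by exact_mod_cast hl.2.pos
          have hlL : Real.log l ≤ Real.log L := Real.log_le_log hl0 (by exact_mod_cast hl.1.2)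
          calc _ ≤ (l : ℝ)⁻¹ * (10000 * (1 + Real.log l + Real.log (Nat.log 2 Q + 1)) / l) :=
                mul_le_mul_of_nonneg_left (sum_inv_primes_dvd_add_one_le hl.2 Q) (by positivity)
            _ ≤ (l : ℝ)⁻¹ * (10000 * Y / l) := by
                rw [hY]; gcongr
            _ = _ := by field_simp
      _ ≤ 10000 * Y * ∑ l ∈ Ioc z L, ((l : ℝ) ^ 2)⁻¹ := by
          rw [← mul_sum]
          refine mul_le_mul_of_nonneg_left ?_ (by positivity)
          exact sum_le_sum_of_subset_of_nonneg (filter_subset _ _) fun _ _ _ ↦ by positivity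
      _ ≤ 10000 * Y * (z : ℝ)⁻¹ := by
          gcongr; exact sum_Ioc_inv_sq_le z L hz
      _ = _ := by rw [div_eq_mul_inv]
  calc _ ≤ _ := by exact_mod_cast card_le_card h1
    _ ≤ _ := h2
    _ = 3200 * (x / Real.log x) * (∑ i ∈ I, (i.1 : ℝ)⁻¹ * (i.2 : ℝ)⁻¹) +
        #I * (x : ℝ) ^ (1 / 10 : ℝ) := by
        rw [sum_add_distrib, ← mul_sum, sum_const, nsmul_eq_mul]
    _ ≤ 3200 * (x / Real.log x) * (10000 * Y / z) + L * Q * (x : ℝ) ^ (1 / 10 : ℝ) := by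
        gcongr
    _ = _ := by ring

end

/-! ### The range of large q, by a two-dimensional sieve. -/

section
open Finset

/-- The number of `j` for which `l * j - 1` and `l * m * (l * j - 1) - a` are both primes with no
small prime factors. -/
theorem card_filter_prime_pair_le {a : ℤ} (ha0 : a ≠ 0) {x l m n : ℕ} (hx : 2 ^ 100 ≤ x)
    (hl : l.Prime) (hm : 1 ≤ m) (T : Finset ℕ) (hT : T ⊆ Icc 1 n)
    (hT1 : ∀ j ∈ T, ∃ q : ℕ, q.Prime ∧ x < q ^ 4 ∧ (q : ℤ) = l * j - 1)
    (hT2 : ∀ j ∈ T, ∃ p : ℕ, p.Prime ∧ x < p ^ 2 ∧ (p : ℤ) = l * m * (l * j - 1) - a) :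
    (#T : ℝ) ≤ 1280000 * sumInvDivisors (2 * a.natAbs) ^ 2 * sumInvDivisors m ^ 2 * n /
      Real.log x ^ 2 + (x : ℝ) ^ (1 / 8 : ℝ) := by
  classical
  obtain ⟨R, hR2, hRx, hlog⟩ := exists_sieve_level hx
  have hx1 : (1 : ℝ) < x := by exact_mod_cast lt_of_lt_of_le (by norm_num) hx
  have hxpos : 0 < Real.log x := Real.log_pos hx1
  -- In j the forms are lj - 1 and l^2 m j - (lm + a), with determinant la. `B` is a multiple of 2,
  -- of both leading coefficients and of the determinant, and is nonzero because a ≠ 0.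
  set B := 2 * a.natAbs * l ^ 2 * m with hB
  have ha1 : 0 < a.natAbs := Int.natAbs_pos.2 ha0
  have hB0 : B ≠ 0 := by have := hl.pos; positivity
  -- A sifting prime r dividing the prime k must equal it, so k^e ≤ R^(2e) ≤ R^100 ≤ x; used with e
  -- = 4 for q and e = 2 for p.
  have hsmall : ∀ {r k e : ℕ}, r ≤ R ^ 2 → x < k ^ e → 2 * e ≤ 100 → r ∣ k → r.Prime → k.Prime →
      False := by
    intro r k e hr hk he hd hrp hkp
    rw [Nat.prime_dvd_prime_iff_eq hrp hkp] at hd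
    subst hd
    have h1 : r ^ e ≤ (R ^ 2) ^ e := Nat.pow_le_pow_left hr e
    rw [← pow_mul] at h1
    have h2 : R ^ (2 * e) ≤ R ^ 100 := Nat.pow_le_pow_right (by omega) he
    omega
  have hBa : (B : ℤ) = 2 * |a| * l ^ 2 * m := by rw [hB]; push_cast; rfl
  have haabs : a ∣ |a| := (dvd_abs a a).2 dvd_rfl
  have hs := card_sifted_mul_linear_le (c₁ := l) (b₁ := 1) (c₂ := l ^ 2 * m) (b₂ := l * m + a)
    hB0 ⟨a.natAbs * l ^ 2 * m, by rw [hB]; ring⟩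
    ⟨2 * |a| * l * m, by rw [hBa]; ring⟩ ⟨2 * |a|, by rw [hBa]; ring⟩
    (by
      obtain ⟨c, hc⟩ := haabs
      exact ⟨2 * c * l * m, by rw [hBa, hc]; ring⟩) n hR2
  have hsub : T ⊆ (Icc 1 n).filter (fun j : ℕ ↦ ∀ p : ℕ, p.Prime → p ≤ R ^ 2 → ¬ p ∣ B →
      ¬ (p : ℤ) ∣ ((l : ℤ) * j - 1) * ((l : ℤ) ^ 2 * m * j - (l * m + a))) := by
    intro j hj
    rw [mem_filter]
    refine ⟨hT hj, fun r hr hrR _ hd ↦ ?_⟩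
    obtain ⟨q, hq, hqx, hqe⟩ := hT1 j hj
    obtain ⟨p, hp, hpx, hpe⟩ := hT2 j hj
    have e1 : (l : ℤ) ^ 2 * m * j - (l * m + a) = p := by rw [hpe]; ring
    rw [← hqe, e1] at hd
    have hd' : r ∣ q * p := by exact_mod_cast hd
    rcases (Nat.Prime.dvd_mul hr).1 hd' with h | h
    · exact hsmall hrR hqx (by norm_num) h hr hq
    · exact hsmall hrR hpx (by norm_num) h hr hp
  have hsB : sumInvDivisors B ≤ sumInvDivisors (2 * a.natAbs) * 2 * sumInvDivisors m := by
    refine (sumInvDivisors_mul_le _ _).trans ?_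
    have h1 := sumInvDivisors_nonneg m
    have h2 := sumInvDivisors_nonneg (2 * a.natAbs)
    have h3 := sumInvDivisors_prime_pow_le (k := 2) hl
    gcongr
    exact (sumInvDivisors_mul_le _ _).trans (by gcongr)
  have hpow : (R : ℝ) ^ 12 ≤ (x : ℝ) ^ (1 / 8 : ℝ) := by
    refine (pow_le_rpow_of_pow_le hRx 12).trans ?_
    exact Real.rpow_le_rpow_of_exponent_le hx1.le (by norm_num)
  have hsB0 := sumInvDivisors_nonneg B
  calc (#T : ℝ) ≤ _ := by exact_mod_cast card_le_card hsub
    _ ≤ _ := hs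
    _ ≤ 8 * (sumInvDivisors (2 * a.natAbs) * 2 * sumInvDivisors m) ^ 2 * n /
        (Real.log x / 200) ^ 2 + (x : ℝ) ^ (1 / 8 : ℝ) := by
        gcongr
        linarith
    _ = _ := by field_simp; ring

/-- Few shifted primes have prime factors `l` and `q` with `q ≡ -1 (mod l)`, where `l` is of
moderate size and `q` is large. -/
theorem exists_card_largePrimes_exists_large_le {a : ℤ} (ha0 : a ≠ 0) :
    ∃ C : ℝ, 0 < C ∧ ∀ x z L Q : ℕ, 2 ^ 100 ≤ x → a ^ 2 ≤ x → 1 ≤ z → 1 ≤ Q → x ≤ Q ^ 4 →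
    ∀ [DecidablePred fun p : ℕ ↦ ∃ l q : ℕ, z < l ∧ l ≤ L ∧ Q < q ∧ l.Prime ∧ q.Prime ∧ l ∣ q + 1 ∧
      ((l * q : ℕ) : ℤ) ∣ p + a],
    (#{p ∈ largePrimes x | ∃ l q : ℕ, z < l ∧ l ≤ L ∧ Q < q ∧ l.Prime ∧ q.Prime ∧ l ∣ q + 1 ∧
      ((l * q : ℕ) : ℤ) ∣ ((p : ℕ) : ℤ) + a} : ℝ) ≤
      C * (x / Real.log x) / z + L * (2 * x / Q) * (x : ℝ) ^ (1 / 8 : ℝ) := by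
  classical
  obtain ⟨C₀, hC₀, hsum⟩ := exists_sum_sumInvDivisors_sq_le
  set s := sumInvDivisors (2 * a.natAbs) with hs
  have hs0 : 1 ≤ s := one_le_sumInvDivisors (by have := Int.natAbs_pos.2 ha0; omega)
  refine ⟨1280000 * s ^ 2 * 4 * (C₀ * 3), by positivity, ?_⟩
  intro x z L Q hx ha hz hQ hxQ _
  have hx1 : (1 : ℝ) < x := by exact_mod_cast lt_of_lt_of_le (by norm_num) hx
  have hxpos : 0 < Real.log x := Real.log_pos hx1
  -- Since q > Q, the cofactor m = N/(lq) is at most M. The roles are switched: l and m are fixed,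
  -- and j with q = lj - 1 varies.
  set M := 2 * x / Q with hM
  set I := ((Ioc z L).filter Nat.Prime) ×ˢ Icc 1 M with hI
  let P : ℕ × ℕ → ℕ → Prop := fun i p ↦ ∃ j : ℕ, 1 ≤ j ∧ (i.1 * j - 1).Prime ∧ Q < i.1 * j - 1 ∧
    (p : ℤ) = i.1 * i.2 * (i.1 * j - 1) - a
  have h1 : (largePrimes x).filter (fun p : ℕ ↦ ∃ l q : ℕ, z < l ∧ l ≤ L ∧ Q < q ∧ l.Prime ∧
      q.Prime ∧ l ∣ q + 1 ∧ ((l * q : ℕ) : ℤ) ∣ p + a) ⊆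
      (largePrimes x).filter (fun p : ℕ ↦ ∃ i ∈ I, P i p) := by
    intro p hp
    rw [mem_filter] at hp ⊢
    obtain ⟨hp, l, q, h1, h2, h3, h4, h5, ⟨j, hj⟩, h7⟩ := hp
    obtain ⟨N, hN, hN1, hN2⟩ := exists_shift_eq ha hp
    rw [← hN, Int.natCast_dvd_natCast] at h7
    obtain ⟨m, rfl⟩ := h7
    have hj0 : 0 < j := Nat.pos_of_ne_zero (by rintro rfl; simp at hj)
    have hm0 : 0 < m := Nat.pos_of_ne_zero (by rintro rfl; simp at hN1)
    have hq : l * j - 1 = q := by omega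
    have hqz : (l : ℤ) * j - 1 = q := by have : ((q + 1 : ℕ) : ℤ) = (l * j : ℕ) := by rw [hj]
                                         push_cast at this; linarith
    refine ⟨hp, (l, m), ?_, j, hj0, ?_, ?_, ?_⟩
    · simp only [hI, mem_product, mem_filter, mem_Ioc, mem_Icc]
      refine ⟨⟨⟨h1, h2⟩, h4⟩, hm0, (Nat.le_div_iff_mul_le hQ).2 ?_⟩
      calc m * Q ≤ m * (l * q) := Nat.mul_le_mul_left _
            (h3.le.trans (Nat.le_mul_of_pos_left _ h4.pos))
        _ = l * q * m := by ring
        _ ≤ _ := hN2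
    · simpa only [hq] using h5
    · simpa only [hq] using h3
    · simp only [hqz]
      push_cast at hN
      linarith
  have h2 := card_filter_exists_le (largePrimes x) I P
    (fun i ↦ 1280000 * s ^ 2 * 4 * (x / Real.log x ^ 2) *
      (((i.1 : ℝ) ^ 2)⁻¹ * (sumInvDivisors i.2 ^ 2 / i.2)) + (x : ℝ) ^ (1 / 8 : ℝ)) (by
      rintro ⟨l, m⟩ hi
      simp only [hI, mem_product, mem_filter, mem_Ioc, mem_Icc] at hi ⊢
      obtain ⟨⟨-, hl⟩, hm, -⟩ := hi
      have hex : ∀ p ∈ (largePrimes x).filter (P (l, m)), ∃ j : ℕ, 1 ≤ j ∧ (l * j - 1).Prime ∧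
          Q < l * j - 1 ∧ (p : ℤ) = l * m * (l * j - 1) - a := fun p hp ↦ (mem_filter.1 hp).2
      choose! g hg1 hg2 hg3 hg4 using hex
      have hinj : Set.InjOn g ((largePrimes x).filter (P (l, m))) := by
        intro p hp p' hp' h
        have e1 := hg4 p hp
        have e2 := hg4 p' hp'
        rw [h] at e1
        exact_mod_cast e1.trans e2.symm
      have hcast : ∀ j : ℕ, 1 ≤ j → ((l * j - 1 : ℕ) : ℤ) = (l : ℤ) * j - 1 := fun j hj ↦ by
        rw [Nat.cast_sub (Nat.mul_pos hl.pos hj)]; push_cast; rfl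
      -- The range of j follows from lm(lj - 1) = N ≤ 2x and lj - 1 ≥ lj/2.
      have hc := card_filter_prime_pair_le ha0 (n := 4 * x / (l ^ 2 * m)) hx hl hm
        (((largePrimes x).filter (P (l, m))).image g) (by
          intro j hj
          obtain ⟨p, hp, rfl⟩ := mem_image.1 hj
          obtain ⟨N, hN, hN1, hN2⟩ := exists_shift_eq ha (mem_filter.1 hp).1
          rw [mem_Icc]
          have hj1 := hg1 p hp
          refine ⟨hj1, (Nat.le_div_iff_mul_le (Nat.mul_pos (pow_pos hl.pos 2) hm)).2 ?_⟩
          have e := hg4 p hp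
          have hlj : (2 : ℤ) ≤ l * g p := by
            exact_mod_cast hl.two_le.trans (Nat.le_mul_of_pos_right l hj1)
          have hlm : (0 : ℤ) ≤ l * m := by positivity
          have hN' : (l : ℤ) * m * (l * g p - 1) ≤ 2 * x := by
            have : (N : ℤ) ≤ 2 * x := by exact_mod_cast hN2
            linarith
          have : (g p : ℤ) * (l ^ 2 * m) ≤ 4 * x := by nlinarith
          exact_mod_cast this)
        (by
          intro j hj
          obtain ⟨p, hp, rfl⟩ := mem_image.1 hj
          refine ⟨l * g p - 1, hg2 p hp, ?_, hcast _ (hg1 p hp)⟩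
          exact lt_of_le_of_lt hxQ (Nat.pow_lt_pow_left (hg3 p hp) (by norm_num)))
        (by
          intro j hj
          obtain ⟨p, hp, rfl⟩ := mem_image.1 hj
          obtain ⟨-, hpp, hpx⟩ := mem_largePrimes.1 (mem_filter.1 hp).1
          exact ⟨p, hpp, hpx, hg4 p hp⟩)
      rw [card_image_of_injOn hinj] at hc
      refine hc.trans ?_
      have hl0 : (0 : ℝ) < l := by exact_mod_cast hl.pos
      have hm0 : (0 : ℝ) < m := by exact_mod_cast hm
      have hdiv : ((4 * x / (l ^ 2 * m) : ℕ) : ℝ) ≤ 4 * x / (l ^ 2 * m) := by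
        refine Nat.cast_div_le.trans ?_
        push_cast; rfl
      gcongr
      calc _ ≤ 1280000 * s ^ 2 * sumInvDivisors m ^ 2 * (4 * x / (l ^ 2 * m)) / Real.log x ^ 2 := by
            gcongr
        _ = _ := by field_simp)
  have hQ0 : (0 : ℝ) < Q := by exact_mod_cast hQ
  have hMle : (M : ℝ) ≤ 2 * x / Q := by
    refine Nat.cast_div_le.trans ?_
    push_cast; rfl
  have hcard : (#I : ℝ) ≤ L * (2 * x / Q) := by
    have : #I ≤ L * M := by
      rw [hI, card_product, Nat.card_Icc, Nat.add_sub_cancel]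
      exact Nat.mul_le_mul_right _ ((card_filter_le _ _).trans (by simp))
    calc (#I : ℝ) ≤ L * M := by exact_mod_cast this
      _ ≤ _ := by gcongr
  have hlogM : 1 + Real.log M ≤ 3 * Real.log x := by
    have h3 : Real.log M ≤ Real.log (2 * x) := by
      rcases Nat.eq_zero_or_pos M with h | h
      · rw [h]; simp only [Nat.cast_zero, Real.log_zero]
        exact Real.log_nonneg (by linarith)
      · refine Real.log_le_log (by exact_mod_cast h) (hMle.trans ?_)
        exact div_le_self (by positivity) (by exact_mod_cast hQ)
    have h4 : 1 ≤ Real.log x := by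
      rw [Real.le_log_iff_exp_le (by linarith)]
      have h5 : (3 : ℝ) ≤ x := by exact_mod_cast le_trans (by norm_num) hx
      have := Real.exp_one_lt_d9
      linarith
    rw [Real.log_mul (by norm_num) (by linarith)] at h3
    have := Real.log_two_lt_d9
    linarith
  -- The sum over m costs one factor log x, leaving x/log x out of x/(log x)^2; the sum over l gives
  -- 1/z.
  have hsumI : ∑ i ∈ I, ((i.1 : ℝ) ^ 2)⁻¹ * (sumInvDivisors i.2 ^ 2 / i.2) ≤
      (z : ℝ)⁻¹ * (C₀ * (3 * Real.log x)) := by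
    rw [hI, sum_product]
    dsimp only
    rw [← sum_mul_sum]
    have h3 : ∑ l ∈ (Ioc z L).filter Nat.Prime, ((l : ℝ) ^ 2)⁻¹ ≤ (z : ℝ)⁻¹ :=
      (sum_le_sum_of_subset_of_nonneg (filter_subset _ _) fun _ _ _ ↦ by positivity).trans
        (sum_Ioc_inv_sq_le z L hz)
    have h4 : ∑ m ∈ Icc 1 M, sumInvDivisors m ^ 2 / m ≤ C₀ * (3 * Real.log x) :=
      (hsum M).trans (by gcongr)
    refine mul_le_mul h3 h4 (sum_nonneg fun _ _ ↦ by positivity) (by positivity)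
  calc _ ≤ _ := by exact_mod_cast card_le_card h1
    _ ≤ _ := h2
    _ = 1280000 * s ^ 2 * 4 * (x / Real.log x ^ 2) *
        (∑ i ∈ I, ((i.1 : ℝ) ^ 2)⁻¹ * (sumInvDivisors i.2 ^ 2 / i.2)) +
        #I * (x : ℝ) ^ (1 / 8 : ℝ) := by
        rw [sum_add_distrib, ← mul_sum, sum_const, nsmul_eq_mul]
    _ ≤ 1280000 * s ^ 2 * 4 * (x / Real.log x ^ 2) * ((z : ℝ)⁻¹ * (C₀ * (3 * Real.log x))) +
        L * (2 * x / Q) * (x : ℝ) ^ (1 / 8 : ℝ) := by gcongr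
    _ = _ := by field_simp

end

/-! ### Prime powers dividing gcd(N, σ(N)). -/

section
open Finset ArithmeticFunction

/-- If `N` has no large square factor `m ^ 2` with `m` a prime power, and no large prime factor
`l` together with a prime factor `q` such that `q ≡ -1 (mod l)`, then `gcd(N, σ(N))` divides the
smooth part of `N`. -/
theorem log_gcd_sigma_le {N w : ℕ} (hN : 1 ≤ N)
    (h1 : ∀ m : ℕ, w < m → IsPrimePow m → ¬ m ^ 2 ∣ N)
    (h2 : ∀ l q : ℕ, 2 * w ^ 3 < l → l.Prime → q.Prime → l ∣ q + 1 → ¬ l * q ∣ N) :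
    Real.log (Nat.gcd N (sigma 1 N)) ≤ ∑ d ∈ Icc 1 (2 * w ^ 3) with d ∣ N, vonMangoldt d := by
  have hN0 : N ≠ 0 := by omega
  -- Apply `h1` to m = p^⌊k/2⌋: m^2 divides p^k, so m ≤ w, and k ≤ 3⌊k/2⌋ for k ≥ 2.
  have hpow : ∀ p k : ℕ, p.Prime → 2 ≤ k → p ^ k ∣ N → p ^ k ≤ w ^ 3 := by
    intro p k hp hk hd
    have hm : p ^ (k / 2) ≤ w := by
      by_contra h
      refine h1 (p ^ (k / 2)) (not_le.1 h) (hp.isPrimePow.pow (by omega)) ?_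
      rw [← pow_mul]
      exact (pow_dvd_pow p (by omega)).trans hd
    calc p ^ k ≤ p ^ (k / 2 * 3) := Nat.pow_le_pow_right hp.pos (by omega)
      _ = (p ^ (k / 2)) ^ 3 := by rw [pow_mul]
      _ ≤ w ^ 3 := Nat.pow_le_pow_left hm 3
  have hprime : ∀ l : ℕ, l.Prime → l ∣ N → l ∣ sigma 1 N → l ≤ 2 * w ^ 3 := by
    intro l hl hlN hls
    by_contra hlw
    rw [not_le] at hlw
    have hs : sigma 1 N = ∏ p ∈ N.primeFactors, sigma 1 (p ^ N.factorization p) := by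
      rw [isMultiplicative_sigma.multiplicative_factorization _ hN0]
      rfl
    rw [hs, hl.prime.dvd_finsetProd_iff] at hls
    obtain ⟨q, hq, hlq⟩ := hls
    have hqp := Nat.prime_of_mem_primeFactors hq
    have hqN := Nat.dvd_of_mem_primeFactors hq
    set k := N.factorization q with hk
    have hk1 : 1 ≤ k := (hqp.dvd_iff_one_le_factorization hN0).1 hqN
    have hqk : q ^ k ∣ N := Nat.ordProj_dvd N q
    -- For k = 1, l divides q + 1, so l ≠ q and lq divides N, against `h2`. For k ≥ 2, l ≤ σ(q^k) <
    -- 2q^k ≤ 2w^3, which is where the threshold comes from.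
    rcases hk1.eq_or_lt with h | h
    · rw [← h, pow_one, sigma_one_apply, hqp.sum_divisors] at hlq
      refine h2 l q hlw hl hqp hlq ?_
      refine Nat.Coprime.mul_dvd_of_dvd_of_dvd ?_ hlN hqN
      refine (Nat.coprime_primes hl hqp).2 ?_
      rintro rfl
      have : l ∣ 1 := by simpa using hlq
      exact hl.one_lt.ne' (Nat.dvd_one.1 this)
    · have hsig : sigma 1 (q ^ k) < 2 * q ^ k := by
        have : ∀ k : ℕ, ∑ i ∈ range (k + 1), q ^ i < 2 * q ^ k := by
          intro k
          induction k with
          | zero => simp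
          | succ k ih =>
            rw [sum_range_succ, pow_succ q k]
            have := Nat.mul_le_mul_left (q ^ k) hqp.two_le
            linarith
        rw [sigma_one_apply, Nat.sum_divisors_prime_pow hqp]
        exact this k
      have hpos : 0 < sigma 1 (q ^ k) := by
        rw [sigma_one_apply]
        exact sum_pos (fun d hd ↦ Nat.pos_of_mem_divisors hd) ⟨1, by simp [hqp.ne_zero]⟩
      have h3 := Nat.le_of_dvd hpos hlq
      have h4 := hpow q k hqp h hqk
      omega
  -- Log of the gcd is the sum of Λ over its divisors, and only prime powers contribute.
  rw [← vonMangoldt_sum]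
  have hsub : ∀ d ∈ (N.gcd (sigma 1 N)).divisors, vonMangoldt d ≠ 0 →
      d ∈ (Icc 1 (2 * w ^ 3)).filter (· ∣ N) := by
    intro d hd hd0
    rw [vonMangoldt_ne_zero_iff] at hd0
    have hdG := Nat.dvd_of_mem_divisors hd
    have hdN := hdG.trans (Nat.gcd_dvd_left _ _)
    obtain ⟨p, k, hp, hk, rfl⟩ := (isPrimePow_nat_iff d).1 hd0
    rw [mem_filter, mem_Icc]
    refine ⟨⟨pow_pos hp.pos k, ?_⟩, hdN⟩
    rcases (Nat.one_le_iff_ne_zero.2 hk.ne').eq_or_lt with h | h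
    · rw [← h, pow_one] at hdG ⊢
      exact hprime p hp (hdG.trans (Nat.gcd_dvd_left _ _)) (hdG.trans (Nat.gcd_dvd_right _ _))
    · have := hpow p k hp h hdN
      omega
  rw [← sum_filter_ne_zero]
  refine sum_le_sum_of_subset_of_nonneg ?_ fun _ _ _ ↦ vonMangoldt_nonneg
  intro d hd
  rw [mem_filter] at hd
  exact hsub d hd.1 hd.2

end

/-! ### Union of the exceptional sets. -/

section
open Finset ArithmeticFunction

open scoped Classical in
/-- The number of primes in `(√x, x]` whose shift has a large common divisor with its sum of
divisors. -/
theorem exists_card_largePrimes_log_gcd_gt_le {a : ℤ} (ha0 : a ≠ 0) :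
    ∃ C : ℝ, 0 < C ∧ ∀ x w L Q : ℕ, ∀ T : ℝ, 2 ^ 100 ≤ x → a ^ 2 ≤ x → 1 ≤ w → 1 ≤ L → 1 ≤ Q →
      x ≤ Q ^ 4 → 0 < T →
    (#{p ∈ largePrimes x | ∃ N : ℕ, (N : ℤ) = (p : ℕ) + a ∧
        T < Real.log (Nat.gcd N (sigma 1 N))} : ℝ) ≤
      (1600 * (x / Real.log x) / w + 2 * (x : ℝ) ^ (3 / 4 : ℝ)) +
      4 * x * (1 + Real.log (2 * x)) / L +
      (32000000 * (x / Real.log x) * (1 + Real.log L + Real.log (Nat.log 2 Q + 1)) /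
        (2 * w ^ 3 : ℕ) + L * Q * (x : ℝ) ^ (1 / 10 : ℝ)) +
      (C * (x / Real.log x) / (2 * w ^ 3 : ℕ) + L * (2 * x / Q) * (x : ℝ) ^ (1 / 8 : ℝ)) +
      (1600 * (x / Real.log x) * (Real.log (2 * w ^ 3 : ℕ) + 6) +
        (2 * w ^ 3 : ℕ) * Real.log (2 * w ^ 3 : ℕ) * (x : ℝ) ^ (1 / 10 : ℝ)) / T := by
  obtain ⟨C, hC, hlarge⟩ := exists_card_largePrimes_exists_large_le ha0
  refine ⟨C, hC, fun x w L Q T hx ha hw hL hQ hxQ hT ↦ ?_⟩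
  have hx1 : 1 ≤ x := le_trans (by norm_num) hx
  set z := 2 * w ^ 3 with hz
  have hz1 : 1 ≤ z := by have : 0 < w ^ 3 := by positivity
                         omega
  have b1 := card_largePrimes_sq_dvd_le hx ha hw
  have b2 := card_largePrimes_exists_very_large_le hx1 ha hL
  have b3 := card_largePrimes_exists_small_le (L := L) (Q := Q) hx ha hz1
  have b4 := hlarge x z L Q hx ha hz1 hQ hxQ
  have b5 := sum_largePrimes_vonMangoldt_le (z := z) hx ha
  set E₁ := (largePrimes x).filter (fun p : ℕ ↦ ∃ m : ℕ, w < m ∧ IsPrimePow m ∧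
    ((m ^ 2 : ℕ) : ℤ) ∣ p + a) with hE₁
  set E₂ := (largePrimes x).filter (fun p : ℕ ↦ ∃ l q : ℕ, L < l ∧ l ∣ q + 1 ∧ 1 ≤ q ∧
    ((l * q : ℕ) : ℤ) ∣ p + a) with hE₂
  set E₃ := (largePrimes x).filter (fun p : ℕ ↦ ∃ l q : ℕ, z < l ∧ l ≤ L ∧ q ≤ Q ∧ l.Prime ∧
    q.Prime ∧ l ∣ q + 1 ∧ ((l * q : ℕ) : ℤ) ∣ p + a) with hE₃
  set E₄ := (largePrimes x).filter (fun p : ℕ ↦ ∃ l q : ℕ, z < l ∧ l ≤ L ∧ Q < q ∧ l.Prime ∧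
    q.Prime ∧ l ∣ q + 1 ∧ ((l * q : ℕ) : ℤ) ∣ p + a) with hE₄
  set F : ℕ → ℝ := fun p ↦ ∑ d ∈ Icc 1 z with ((d : ℕ) : ℤ) ∣ (p : ℤ) + a, vonMangoldt d with hF
  set E₅ := (largePrimes x).filter (fun p ↦ T ≤ F p) with hE₅
  have hF0 : ∀ p, 0 ≤ F p := fun p ↦ sum_nonneg fun _ _ ↦ vonMangoldt_nonneg
  -- Markov's inequality applied to the first moment `b5`.
  have hmarkov : (#E₅ : ℝ) ≤ (1600 * (x / Real.log x) * (Real.log z + 6) +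
      z * Real.log z * (x : ℝ) ^ (1 / 10 : ℝ)) / T := by
    rw [le_div_iff₀ hT]
    refine le_trans ?_ b5
    calc (#E₅ : ℝ) * T = ∑ p ∈ E₅, T := by simp
      _ ≤ ∑ p ∈ E₅, F p := sum_le_sum fun p hp ↦ (mem_filter.1 hp).2
      _ ≤ _ := sum_le_sum_of_subset_of_nonneg (filter_subset _ _) fun p _ _ ↦ hF0 p
  have hsub : (largePrimes x).filter (fun p : ℕ ↦ ∃ N : ℕ, (N : ℤ) = (p : ℕ) + a ∧
      T < Real.log (Nat.gcd N (sigma 1 N))) ⊆ E₁ ∪ E₂ ∪ E₃ ∪ E₄ ∪ E₅ := by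
    intro p hp
    rw [mem_filter] at hp
    obtain ⟨hp, N, hN, hTN⟩ := hp
    have hN1 : 1 ≤ N := by
      obtain ⟨N', hN', h1, -⟩ := exists_shift_eq ha hp
      have : N = N' := by exact_mod_cast hN.trans hN'.symm
      omega
    have hdvd : ∀ d : ℕ, d ∣ N → (d : ℤ) ∣ p + a := fun d hd ↦ by
      rw [← hN]; exact_mod_cast hd
    by_contra hmem
    simp only [mem_union, not_or] at hmem
    obtain ⟨⟨⟨⟨n1, n2⟩, n3⟩, n4⟩, n5⟩ := hmem
    -- Outside `E₁` there are no large square divisors, and outside `E₂`, `E₃`, `E₄` no pair (l, q)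
    -- in any of the three ranges.
    have hlog := log_gcd_sigma_le (w := w) hN1
      (fun m hm hpp hd ↦ n1 (mem_filter.2 ⟨hp, m, hm, hpp, hdvd _ hd⟩))
      (fun l q hl hlp hqp hlq hd ↦ by
        rcases lt_or_ge L l with h | h
        · exact n2 (mem_filter.2 ⟨hp, l, q, h, hlq, hqp.one_le, hdvd _ hd⟩)
        rcases le_or_gt q Q with h' | h'
        · exact n3 (mem_filter.2 ⟨hp, l, q, hl, h, h', hlp, hqp, hlq, hdvd _ hd⟩)
        · exact n4 (mem_filter.2 ⟨hp, l, q, hl, h, h', hlp, hqp, hlq, hdvd _ hd⟩))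
    refine n5 (mem_filter.2 ⟨hp, hTN.le.trans (hlog.trans (le_of_eq ?_))⟩)
    simp only [hF]
    refine sum_congr (filter_congr fun d _ ↦ ?_) fun _ _ ↦ rfl
    rw [← hN, Int.natCast_dvd_natCast]
  have hcard : #((largePrimes x).filter (fun p : ℕ ↦ ∃ N : ℕ, (N : ℤ) = (p : ℕ) + a ∧
      T < Real.log (Nat.gcd N (sigma 1 N)))) ≤ #E₁ + #E₂ + #E₃ + #E₄ + #E₅ := by
    refine (card_le_card hsub).trans ?_
    have h1 := card_union_le (E₁ ∪ E₂ ∪ E₃ ∪ E₄) E₅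
    have h2 := card_union_le (E₁ ∪ E₂ ∪ E₃) E₄
    have h3 := card_union_le (E₁ ∪ E₂) E₃
    have h4 := card_union_le E₁ E₂
    omega
  calc _ ≤ ((#E₁ + #E₂ + #E₃ + #E₄ + #E₅ : ℕ) : ℝ) := by exact_mod_cast hcard
    _ = (#E₁ : ℝ) + #E₂ + #E₃ + #E₄ + #E₅ := by push_cast; rfl
    _ ≤ _ := by gcongr

end

/-! ### Choice of parameters as x tends to infinity. -/

section
open Finset ArithmeticFunction Filter Topology

open scoped Classical in
set_option maxHeartbeats 1000000 in
/-- For almost all primes `p`, the greatest common divisor of `p + a` and `σ(p + a)` is bounded by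
a power of `log log x`. -/
theorem exists_eventually_card_largePrimes_log_gcd_gt_le_of_ne_zero {a : ℤ} (ha0 : a ≠ 0) {ε : ℝ}
    (hε : 0 < ε) :
    ∃ K : ℝ, 0 < K ∧ ∀ᶠ x : ℕ in atTop,
      (#{p ∈ largePrimes x | ∃ N : ℕ, (N : ℤ) = (p : ℕ) + a ∧
        K * Real.log (Real.log (Real.log x)) < Real.log (Nat.gcd N (sigma 1 N))} : ℝ) ≤
      ε * (x / Real.log x) := by
  obtain ⟨C, hC, hmain⟩ := exists_card_largePrimes_log_gcd_gt_le ha0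
  -- Since log z + 6 ≤ 4u for u = log log log x ≥ 7, the main Markov term is at most 1600·4u·(x/log
  -- x) divided by Ku; this value of K makes it (ε/2)·x/log x.
  refine ⟨12800 / ε, by positivity, ?_⟩
  have hcast : Tendsto (fun x : ℕ ↦ (x : ℝ)) atTop atTop := tendsto_natCast_atTop_atTop
  have hX : Tendsto (fun x : ℕ ↦ Real.log x) atTop atTop := Real.tendsto_log_atTop.comp hcast
  have hy : Tendsto (fun x : ℕ ↦ Real.log (Real.log x)) atTop atTop :=
    Real.tendsto_log_atTop.comp hX
  have hu : Tendsto (fun x : ℕ ↦ Real.log (Real.log (Real.log x))) atTop atTop :=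
    Real.tendsto_log_atTop.comp hy
  have herr : Tendsto (fun x : ℕ ↦ 1000 * (Real.log x ^ (7 : ℝ) / (x : ℝ) ^ (1 / 10 : ℝ)))
      atTop (𝓝 0) := by
    have := ((isLittleO_log_rpow_rpow_atTop (7 : ℝ)
      (by norm_num : (0 : ℝ) < 1 / 10)).tendsto_div_nhds_zero.comp hcast).const_mul 1000
    simpa using this
  have hinv : ∀ c : ℝ, Tendsto (fun x : ℕ ↦ c / Real.log (Real.log x)) atTop (𝓝 0) :=
    fun c ↦ tendsto_const_nhds.div_atTop hy
  have hlim : Tendsto (fun x : ℕ ↦ (3200 + 1280000000 + 4 * C) / Real.log (Real.log x) +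
      12 / Real.log x + 1000 * (Real.log x ^ (7 : ℝ) / (x : ℝ) ^ (1 / 10 : ℝ))) atTop (𝓝 0) := by
    simpa using ((hinv (3200 + 1280000000 + 4 * C)).add
      (tendsto_const_nhds.div_atTop hX)).add herr
  filter_upwards [eventually_ge_atTop (2 ^ 100), eventually_ge_atTop (a ^ 2).toNat,
    hX.eventually_ge_atTop 3, hy.eventually_ge_atTop 2, hu.eventually_ge_atTop 7,
    hu.eventually_ge_atTop (ε / 12800),
    hlim.eventually_le_const (by positivity : 0 < ε / 2)] with x hx ha hX3 hy2 hu7 huε hsmall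
  have ha' : a ^ 2 ≤ x := by
    have := Int.self_le_toNat (a ^ 2)
    exact this.trans (by exact_mod_cast ha)
  set X := Real.log x with hXdef
  set y := Real.log X with hydef
  set u := Real.log y with hudef
  have hx1 : (1 : ℝ) < x := by exact_mod_cast lt_of_lt_of_le (by norm_num) hx
  have hx0 : (0 : ℝ) < x := by linarith
  -- With w of order log log x, z has order (log log x)^3: this beats the log log x lost for small
  -- q, while log z remains O(log log log x).
  set w := ⌊y⌋₊ with hw
  have hwy : (w : ℝ) ≤ y := Nat.floor_le (by linarith)
  have hwy' : y / 2 ≤ w := by have := (Nat.lt_floor_add_one y).le; linarith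
  have hw1 : 1 ≤ w := Nat.one_le_iff_ne_zero.2 (by
    rintro h; rw [h] at hwy'; norm_num at hwy'; linarith)
  set l₂ := Nat.log 2 x with hl₂
  have hl₂X : X ≤ l₂ + 1 := by
    have h1 : (x : ℝ) < 2 ^ (l₂ + 1) := by
      exact_mod_cast Nat.lt_pow_succ_log_self one_lt_two x
    have h2 := Real.log_le_log hx0 h1.le
    rw [Real.log_pow] at h2
    have := Real.log_two_lt_d9
    push_cast at h2
    nlinarith [Nat.cast_nonneg (α := ℝ) l₂]
  have hl₂X' : (l₂ : ℝ) + 1 ≤ 3 * X := by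
    have h1 : (2 : ℝ) ^ l₂ ≤ x := by
      exact_mod_cast Nat.pow_log_le_self 2 (by exact_mod_cast hx0.ne')
    have h2 := Real.log_le_log (by positivity) h1
    rw [Real.log_pow] at h2
    have := Real.log_two_gt_d9
    nlinarith [Nat.cast_nonneg (α := ℝ) l₂]
  -- An integer of order (log x)^3; the very large range needs L to grow faster than (log x)^2.
  set L := (l₂ + 1) ^ 3 with hL
  have hL1 : 1 ≤ L := Nat.one_le_pow _ _ (by omega)
  have hLlow : X ^ 3 ≤ L := by rw [hL]; push_cast; gcongr
  have hLup : (L : ℝ) ≤ 27 * X ^ 3 := by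
    rw [hL]; push_cast
    calc ((l₂ : ℝ) + 1) ^ 3 ≤ (3 * X) ^ 3 := by gcongr
      _ = _ := by ring
  -- At this size both L·Q·x^(1/10) and L·(x/Q)·x^(1/8) save a power of x, and x ≤ Q^4 holds.
  set Q := ⌈(x : ℝ) ^ (1 / 4 : ℝ)⌉₊ with hQ
  have hq1 : 1 ≤ (x : ℝ) ^ (1 / 4 : ℝ) := Real.one_le_rpow hx1.le (by norm_num)
  have hQlow : (x : ℝ) ^ (1 / 4 : ℝ) ≤ Q := Nat.le_ceil _
  have hQup : (Q : ℝ) ≤ 2 * (x : ℝ) ^ (1 / 4 : ℝ) := by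
    have := (Nat.ceil_lt_add_one (by positivity : 0 ≤ (x : ℝ) ^ (1 / 4 : ℝ))).le
    linarith
  have hQ1 : 1 ≤ Q := by exact_mod_cast hq1.trans hQlow
  have hQ4 : x ≤ Q ^ 4 := by
    have : (x : ℝ) ≤ (Q : ℝ) ^ 4 := by
      calc (x : ℝ) = ((x : ℝ) ^ (1 / 4 : ℝ)) ^ 4 := by
            rw [← Real.rpow_natCast, ← Real.rpow_mul hx0.le]; norm_num
        _ ≤ _ := by gcongr
    exact_mod_cast this
  have hQx : Q ≤ x := by
    refine Nat.ceil_le.2 ?_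
    calc (x : ℝ) ^ (1 / 4 : ℝ) ≤ (x : ℝ) ^ (1 : ℝ) :=
          Real.rpow_le_rpow_of_exponent_le hx1.le (by norm_num)
      _ = x := Real.rpow_one _
  have hTpos : 0 < 12800 / ε * u := by positivity
  have hT1 : 1 ≤ 12800 / ε * u := by
    calc (1 : ℝ) = 12800 / ε * (ε / 12800) := by field_simp
      _ ≤ _ := by gcongr
  refine (hmain x w L Q _ hx ha' hw1 hL1 hQ1 hQ4 hTpos).trans ?_
  clear_value w L Q l₂
  have hy0 : 0 < y := by linarith
  have hX0 : 0 < X := by linarith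
  have hu0 : 0 < u := by linarith
  have hyX : y ≤ X := by have := Real.log_le_sub_one_of_pos hX0; linarith
  set A := (x : ℝ) / X with hA
  have hA0 : 0 < A := by positivity
  set z : ℕ := 2 * w ^ 3 with hz
  have hw0 : (0 : ℝ) < w := by linarith
  have hzlow : y ^ 3 / 4 ≤ (z : ℝ) := by
    rw [hz]; push_cast
    calc y ^ 3 / 4 = 2 * (y / 2) ^ 3 := by ring
      _ ≤ _ := by gcongr
  have hzup : (z : ℝ) ≤ 2 * y ^ 3 := by rw [hz]; push_cast; gcongr
  have hz0 : (0 : ℝ) < z := lt_of_lt_of_le (by positivity) hzlow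
  have hlogz : Real.log z ≤ 1 + 3 * u := by
    refine (Real.log_le_log hz0 hzup).trans ?_
    rw [Real.log_mul (by norm_num) (by positivity), Real.log_pow]
    have := Real.log_two_lt_d9
    push_cast
    linarith
  clear_value z
  -- W dominates every power of x in the error terms, the largest exponent being 3/4 + 1/8 = 7/8.
  set W := (x : ℝ) ^ (9 / 10 : ℝ) with hW
  have hW0 : 0 < W := by positivity
  have hWpow : ∀ c : ℝ, c ≤ 9 / 10 → (x : ℝ) ^ c ≤ W := fun c hc ↦
    Real.rpow_le_rpow_of_exponent_le hx1.le hc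
  have t1 : 1600 * A / w ≤ 3200 * A / y := by
    rw [div_le_div_iff₀ hw0 hy0]
    nlinarith
  have t2 : 4 * x * (1 + Real.log (2 * x)) / L ≤ 12 * A / X := by
    have h1 : 1 + Real.log (2 * x) ≤ 3 * X := by
      rw [Real.log_mul (by norm_num) hx0.ne']
      have := Real.log_two_lt_d9
      linarith
    calc 4 * x * (1 + Real.log (2 * x)) / L ≤ 4 * x * (3 * X) / X ^ 3 := by gcongr
      _ = _ := by rw [hA]; field_simp; ring
  have t3 : 32000000 * A * (1 + Real.log L + Real.log (Nat.log 2 Q + 1)) / z ≤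
      1280000000 * A / y := by
    have h3 : Real.log (3 * X) ≤ 2 + y := by
      rw [Real.log_mul (by norm_num) hX0.ne']
      have h4 : Real.log 3 ≤ 2 := by
        have := Real.log_le_sub_one_of_pos (by norm_num : (0 : ℝ) < 3); linarith
      linarith
    have h1 : Real.log L ≤ 3 * (2 + y) := by
      have hL0 : (0 : ℝ) < L := by exact_mod_cast hL1
      refine (Real.log_le_log hL0 hLup).trans ?_
      rw [show 27 * X ^ 3 = (3 * X) ^ 3 by ring, Real.log_pow]
      push_cast
      linarith
    have h2 : Real.log (Nat.log 2 Q + 1) ≤ 2 + y := by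
      refine (Real.log_le_log (by positivity) ?_).trans h3
      have : ((Nat.log 2 Q : ℕ) : ℝ) ≤ l₂ := by
        rw [hl₂]; exact_mod_cast Nat.log_mono_right hQx
      linarith
    calc _ ≤ 32000000 * A * (10 * y) / (y ^ 3 / 4) := by gcongr; linarith
      _ = 1280000000 * A / y / y := by field_simp; ring
      _ ≤ _ := div_le_self (by positivity) (by linarith)
  have t4 : C * A / z ≤ 4 * C * A / y := by
    calc C * A / z ≤ C * A / (y ^ 3 / 4) := by gcongr
      _ = 4 * C * A / y / (y ^ 2) := by field_simp
      _ ≤ _ := div_le_self (by positivity) (one_le_pow₀ (by linarith))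
  have hz1 : 0 ≤ Real.log z := Real.log_natCast_nonneg z
  have t5 : (1600 * A * (Real.log z + 6) + z * Real.log z * (x : ℝ) ^ (1 / 10 : ℝ)) /
      (12800 / ε * u) ≤ ε / 2 * A + 4 * X ^ 6 * W := by
    rw [add_div]
    refine add_le_add ?_ ?_
    · rw [div_le_iff₀ hTpos]
      calc 1600 * A * (Real.log z + 6) ≤ 1600 * A * (4 * u) := by gcongr; linarith
        _ = _ := by field_simp; ring
    · refine (div_le_self (by positivity) hT1).trans ?_
      have h1 : Real.log z ≤ z := by have := Real.log_le_sub_one_of_pos hz0; linarith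
      calc z * Real.log z * (x : ℝ) ^ (1 / 10 : ℝ) ≤ (2 * y ^ 3) * (2 * y ^ 3) * W := by
            gcongr
            · exact h1.trans hzup
            · exact hWpow _ (by norm_num)
        _ = 4 * y ^ 6 * W := by ring
        _ ≤ _ := by gcongr
  have e1 : 2 * (x : ℝ) ^ (3 / 4 : ℝ) ≤ 2 * W := by
    gcongr; exact hWpow _ (by norm_num)
  have e3 : L * Q * (x : ℝ) ^ (1 / 10 : ℝ) ≤ 54 * X ^ 3 * W := by
    calc L * Q * (x : ℝ) ^ (1 / 10 : ℝ)
        ≤ 27 * X ^ 3 * (2 * (x : ℝ) ^ (1 / 4 : ℝ)) * (x : ℝ) ^ (1 / 10 : ℝ) := by gcongr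
      _ = 54 * X ^ 3 * ((x : ℝ) ^ (1 / 4 : ℝ) * (x : ℝ) ^ (1 / 10 : ℝ)) := by ring
      _ ≤ _ := by
        rw [← Real.rpow_add hx0]
        gcongr; exact hWpow _ (by norm_num)
  have e4 : L * (2 * x / Q) * (x : ℝ) ^ (1 / 8 : ℝ) ≤ 54 * X ^ 3 * W := by
    have h1 : 2 * (x : ℝ) / Q ≤ 2 * (x : ℝ) ^ (3 / 4 : ℝ) := by
      have h2 : (x : ℝ) = (x : ℝ) ^ (3 / 4 : ℝ) * (x : ℝ) ^ (1 / 4 : ℝ) := by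
        rw [← Real.rpow_add hx0]; norm_num
      rw [div_le_iff₀ (by exact_mod_cast hQ1)]
      calc 2 * (x : ℝ) = 2 * (x : ℝ) ^ (3 / 4 : ℝ) * (x : ℝ) ^ (1 / 4 : ℝ) := by
            rw [mul_assoc, ← h2]
        _ ≤ _ := by gcongr
    calc L * (2 * x / Q) * (x : ℝ) ^ (1 / 8 : ℝ)
        ≤ 27 * X ^ 3 * (2 * (x : ℝ) ^ (3 / 4 : ℝ)) * (x : ℝ) ^ (1 / 8 : ℝ) := by gcongr
      _ = 54 * X ^ 3 * ((x : ℝ) ^ (3 / 4 : ℝ) * (x : ℝ) ^ (1 / 8 : ℝ)) := by ring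
      _ ≤ _ := by
        rw [← Real.rpow_add hx0]
        gcongr; exact hWpow _ (by norm_num)
  have herrs : 2 * W + 54 * X ^ 3 * W + 54 * X ^ 3 * W + 4 * X ^ 6 * W ≤
      A * (1000 * (X ^ (7 : ℝ) / (x : ℝ) ^ (1 / 10 : ℝ))) := by
    have h1 : A * (1000 * (X ^ (7 : ℝ) / (x : ℝ) ^ (1 / 10 : ℝ))) = 1000 * X ^ 6 * W := by
      have h2 : (x : ℝ) = W * (x : ℝ) ^ (1 / 10 : ℝ) := by
        rw [hW, ← Real.rpow_add hx0]; norm_num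
      have h3 : X ^ (7 : ℝ) = X ^ 6 * X := by
        rw [show (7 : ℝ) = (7 : ℕ) by norm_num, Real.rpow_natCast]; ring
      have h4 : 0 < (x : ℝ) ^ (1 / 10 : ℝ) := by positivity
      rw [h3, hA]
      nth_rewrite 1 [h2]
      field_simp
    have h5 : X ^ 3 ≤ X ^ 6 := pow_le_pow_right₀ (by linarith) (by norm_num)
    have h6 : 1 ≤ X ^ 6 := one_le_pow₀ (by linarith)
    rw [h1]
    nlinarith
  have hfin : 3200 * A / y + 12 * A / X + 1280000000 * A / y + 4 * C * A / y +
      A * (1000 * (X ^ (7 : ℝ) / (x : ℝ) ^ (1 / 10 : ℝ))) ≤ A * (ε / 2) := by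
    refine le_trans (le_of_eq ?_) (mul_le_mul_of_nonneg_left hsmall hA0.le)
    ring
  linarith

end

/-! ### The case a = 0, Chebyshev's bound, and the passage to density zero. -/

section
open Finset ArithmeticFunction Filter Topology

theorem Nat.Prime.gcd_sigma_one {p : ℕ} (hp : p.Prime) : Nat.gcd p (sigma 1 p) = 1 := by
  rw [sigma_one_apply, hp.sum_divisors]
  simp

open scoped Classical in
theorem exists_eventually_card_largePrimes_log_gcd_gt_le (a : ℤ) {ε : ℝ} (hε : 0 < ε) :
    ∃ K : ℝ, 0 < K ∧ ∀ᶠ x : ℕ in atTop,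
      (#{p ∈ largePrimes x | ∃ N : ℕ, (N : ℤ) = (p : ℕ) + a ∧
        K * Real.log (Real.log (Real.log x)) < Real.log (Nat.gcd N (sigma 1 N))} : ℝ) ≤
      ε * (x / Real.log x) := by
  rcases eq_or_ne a 0 with rfl | ha
  -- For a = 0 the determinant la vanishes and the two-dimensional sieve is unavailable, but gcd(p,
  -- p + 1) = 1 leaves nothing to exclude.
  · refine ⟨1, one_pos, ?_⟩
    have hu : Tendsto (fun x : ℕ ↦ Real.log (Real.log (Real.log x))) atTop atTop :=
      Real.tendsto_log_atTop.comp (Real.tendsto_log_atTop.comp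
        (Real.tendsto_log_atTop.comp tendsto_natCast_atTop_atTop))
    filter_upwards [hu.eventually_ge_atTop 0] with x hx
    have hempty : (largePrimes x).filter (fun p : ℕ ↦ ∃ N : ℕ, (N : ℤ) = (p : ℕ) + 0 ∧
        1 * Real.log (Real.log (Real.log x)) < Real.log (Nat.gcd N (sigma 1 N))) = ∅ := by
      refine filter_eq_empty_iff.2 fun p hp ↦ ?_
      rintro ⟨N, hN, h⟩
      have : N = p := by simpa using hN
      rw [this, (mem_largePrimes.1 hp).2.1.gcd_sigma_one] at h
      simp only [Nat.cast_one, Real.log_one] at h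
      linarith
    rw [hempty, card_empty, Nat.cast_zero]
    have := Real.log_natCast_nonneg x
    positivity
  · exact exists_eventually_card_largePrimes_log_gcd_gt_le_of_ne_zero ha hε

/-- Chebyshev's lower bound has constant log 2 > 1/2, and the excess absorbs the lower-order term.
Relative density zero needs only the order of magnitude of π(x). -/
theorem eventually_div_log_le_primeCounting :
    ∀ᶠ x : ℕ in atTop, (x : ℝ) / (2 * Real.log x) ≤ Nat.primeCounting x := by
  have hcast : Tendsto (fun x : ℕ ↦ (x : ℝ)) atTop atTop := tendsto_natCast_atTop_atTop
  have h0 : Tendsto (fun x : ℕ ↦ Real.log x / x) atTop (𝓝 0) :=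
    Real.isLittleO_log_id_atTop.tendsto_div_nhds_zero.comp hcast
  filter_upwards [h0.eventually_le_const (by norm_num : (0 : ℝ) < 1 / 20),
    eventually_ge_atTop 20] with x hx hx20
  have hx0 : (20 : ℝ) ≤ x := by exact_mod_cast hx20
  have hlog : 0 < Real.log x := Real.log_pos (by linarith)
  refine le_trans ?_ (Chebyshev.pi_ge x)
  rw [div_le_iff₀ (by linarith)] at hx
  have h1 : Real.log (x + 1) ≤ 1 + Real.log x := by
    have h2 : Real.log ((x : ℝ) + 1) ≤ Real.log (2 * x) :=
      Real.log_le_log (by linarith) (by linarith)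
    rw [Real.log_mul (by norm_num) (by linarith)] at h2
    have := Real.log_two_lt_d9
    linarith
  rw [← div_div]
  gcongr
  have := Real.log_two_gt_d9
  nlinarith

/-- A shift `N = p + a` with `log gcd(N, σ(N)) ≤ K log log log x` satisfies the required bound. -/
theorem gcd_le_log_log_rpow {x N g : ℕ} {K r : ℝ} (hK : 0 < K)
    (hy : 4 ≤ Real.log (Real.log x)) (hNx : x ≤ N ^ 3) (hr : 2 * K ≤ r) (hg0 : 0 < g)
    (hg : Real.log g ≤ K * Real.log (Real.log (Real.log x))) :
    (g : ℝ) ≤ Real.log (Real.log (N : ℝ)) ^ r := by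
  have hX : 0 < Real.log x := by
    by_contra h
    have h1 : Real.log x = 0 := le_antisymm (not_lt.1 h) (Real.log_natCast_nonneg x)
    rw [h1, Real.log_zero] at hy
    linarith
  have hx0 : (0 : ℝ) < x := by
    rcases Nat.eq_zero_or_pos x with h | h
    · rw [h] at hX; simp at hX
    · exact_mod_cast h
  set y := Real.log (Real.log x) with hydef
  have h1 : Real.log x ≤ 3 * Real.log N := by
    have h2 : (x : ℝ) ≤ (N : ℝ) ^ 3 := by exact_mod_cast hNx
    have h3 := Real.log_le_log hx0 h2
    rw [Real.log_pow] at h3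
    exact_mod_cast h3
  have h2 : y - 2 ≤ Real.log (Real.log N) := by
    have h3 : Real.log (Real.log x / 3) ≤ Real.log (Real.log N) :=
      Real.log_le_log (by positivity) (by linarith)
    rw [Real.log_div hX.ne' (by norm_num)] at h3
    have h4 := Real.log_le_sub_one_of_pos (by norm_num : (0 : ℝ) < 3)
    linarith
  -- For y ≥ 4, y - 2 ≥ √y. Passing from x to N therefore costs at most a factor 2 in the triple
  -- logarithm, whence r ≥ 2K.
  have h3 : Real.log y / 2 ≤ Real.log (Real.log (Real.log N)) := by
    have h4 : √y ≤ Real.log (Real.log N) := by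
      refine le_trans ?_ h2
      rw [Real.sqrt_le_left (by linarith)]
      nlinarith
    have h5 := Real.log_le_log (Real.sqrt_pos.2 (by linarith)) h4
    rwa [Real.log_sqrt (by linarith)] at h5
  have hpos : 0 < Real.log (Real.log N) := by linarith
  have hlogy : 0 ≤ Real.log y := Real.log_nonneg (by linarith)
  rw [Real.rpow_def_of_pos hpos, ← Real.log_le_iff_le_exp (by exact_mod_cast hg0)]
  refine hg.trans ?_
  calc K * Real.log y = Real.log y / 2 * (2 * K) := by ring
    _ ≤ _ := by gcongr; linarith

end

theorem theorem1p3 (a : ℤ) (f : ℕ → ℝ) (hf : Filter.Tendsto f Filter.atTop Filter.atTop) :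
    ∃ E : Set ℕ, (∀ p ∈ E, p.Prime) ∧ HasPrimeDensityZero E ∧
      ∀ p : ℕ, p.Prime → p ∉ E →
        ∃ N : ℕ, (N : ℤ) = (p : ℤ) + a ∧ 3 ≤ N ∧
          (Nat.gcd N (ArithmeticFunction.sigma 1 N) : ℝ) ≤
            Real.log (Real.log (N : ℝ)) ^ f N := by
  classical
  set E : Set ℕ := {p | p.Prime ∧ ¬ ∃ N : ℕ, (N : ℤ) = (p : ℤ) + a ∧ 3 ≤ N ∧
          (Nat.gcd N (ArithmeticFunction.sigma 1 N) : ℝ) ≤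
            Real.log (Real.log (N : ℝ)) ^ f N} with hE
  refine ⟨E, fun p hp ↦ hp.1, ?_, fun p hp hpE ↦ by
    by_contra h
    exact hpE ⟨hp, h⟩⟩
  rw [HasPrimeDensityZero, Metric.tendsto_nhds]
  intro ε hε
  -- The bad large primes and the primes up to √x each get (ε/8)·x/log x; as x/log x ≤ 2π(x), the
  -- total is at most (ε/2)π(x).
  obtain ⟨K, hK, hbad⟩ := exists_eventually_card_largePrimes_log_gcd_gt_le a
    (by positivity : 0 < ε / 8)
  obtain ⟨n₀, hn₀⟩ := Filter.eventually_atTop.1 (hf.eventually_ge_atTop (2 * K))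
  have hcast : Filter.Tendsto (fun x : ℕ ↦ (x : ℝ)) Filter.atTop Filter.atTop :=
    tendsto_natCast_atTop_atTop
  have hlim : Filter.Tendsto (fun x : ℕ ↦ Real.log x / (x : ℝ) ^ (1 / 2 : ℝ)) Filter.atTop
      (nhds 0) :=
    (isLittleO_log_rpow_atTop (by norm_num : (0 : ℝ) < 1 / 2)).tendsto_div_nhds_zero.comp hcast
  have hy : Filter.Tendsto (fun x : ℕ ↦ Real.log (Real.log x)) Filter.atTop Filter.atTop :=
    Real.tendsto_log_atTop.comp (Real.tendsto_log_atTop.comp hcast)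
  filter_upwards [hbad, eventually_div_log_le_primeCounting,
    hlim.eventually_le_const (by positivity : 0 < ε / 8), hy.eventually_ge_atTop 4,
    Filter.eventually_ge_atTop ((n₀ + 4) ^ 3), Filter.eventually_ge_atTop (4 * (a ^ 2).toNat),
    Filter.eventually_ge_atTop 64] with x hbad hpi hsqrt hy4 hxn hxa hx64
  have hx0 : (64 : ℝ) ≤ x := by exact_mod_cast hx64
  have hX : 0 < Real.log x := Real.log_pos (by linarith)
  set S := (largePrimes x).filter (fun p : ℕ ↦ ∃ N : ℕ, (N : ℤ) = (p : ℕ) + a ∧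
        K * Real.log (Real.log (Real.log x)) <
          Real.log (Nat.gcd N (ArithmeticFunction.sigma 1 N))) with hS
  have ha4 : 4 * a ^ 2 ≤ x := by
    have h1 : ((4 * (a ^ 2).toNat : ℕ) : ℤ) ≤ x := by exact_mod_cast hxa
    have h2 := Int.self_le_toNat (a ^ 2)
    push_cast at h1
    linarith
  have ha : a ^ 2 ≤ x := by nlinarith [sq_nonneg a]
  have hsub : {p : ℕ | p ≤ x ∧ p.Prime ∧ p ∈ E} ⊆ ((Finset.Icc 1 (Nat.sqrt x) ∪ S : Finset ℕ) : Set ℕ) := by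
    rintro p ⟨hpx, hp, hpE⟩
    rw [Finset.mem_coe, Finset.mem_union]
    by_contra hmem
    rw [not_or] at hmem
    obtain ⟨h1, h2⟩ := hmem
    have hpx2 : x < p ^ 2 := by
      by_contra h
      exact h1 (Finset.mem_Icc.2 ⟨hp.one_le, Nat.le_sqrt'.2 (not_lt.1 h)⟩)
    have hpl := mem_largePrimes.2 ⟨hpx, hp, hpx2⟩
    obtain ⟨N, hN, hN1, -⟩ := exists_shift_eq ha hpl
    -- From 4a^2 ≤ x < p^2 one gets 2|a| < p, so N ≥ p/2. Then N ≥ 4 and x < p^2 ≤ 4N^2 ≤ N^3, so N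
    -- exceeds any fixed bound once x is large, in particular the point where f reaches 2K.
    have hNp : (p : ℤ) ≤ 2 * N := by
      have h3 : |2 * a| < |(p : ℤ)| := sq_lt_sq.1 (by
        have : (x : ℤ) < (p : ℤ) ^ 2 := by exact_mod_cast hpx2
        linarith)
      rw [Nat.abs_cast] at h3
      have := neg_abs_le (2 * a)
      linarith
    have hNp' : p ≤ 2 * N := by exact_mod_cast hNp
    have hN4 : 4 ≤ N := by
      by_contra h
      have : p ≤ 6 := by omega
      nlinarith
    have hN3 : x ≤ N ^ 3 := by
      have h3 : p ^ 2 ≤ (2 * N) ^ 2 := Nat.pow_le_pow_left hNp' 2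
      have h4 : 4 * N ^ 2 ≤ N ^ 3 := by
        rw [pow_succ N 2, mul_comm]; exact Nat.mul_le_mul_left _ hN4
      nlinarith
    have hNn : n₀ ≤ N := by
      have : (n₀ + 4) ^ 3 ≤ N ^ 3 := hxn.trans hN3
      have := (Nat.pow_le_pow_iff_left (by norm_num : 3 ≠ 0)).1 this
      omega
    refine hpE.2 ⟨N, hN, by omega, ?_⟩
    refine gcd_le_log_log_rpow hK hy4 hN3 (hn₀ N hNn) (Nat.gcd_pos_of_pos_left _ hN1) ?_
    by_contra h
    exact h2 (Finset.mem_filter.2 ⟨hpl, N, hN, not_le.1 h⟩)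
  have hcard : (Set.ncard {p : ℕ | p ≤ x ∧ p.Prime ∧ p ∈ E} : ℝ) ≤ Nat.sqrt x + S.card := by
    have h1 := Set.ncard_le_ncard hsub (Finset.finite_toSet _)
    rw [Set.ncard_coe_finset] at h1
    have h2 := h1.trans (Finset.card_union_le _ _)
    rw [Nat.card_Icc, Nat.add_sub_cancel] at h2
    exact_mod_cast h2
  have hA : 0 < (x : ℝ) / Real.log x := by positivity
  have hsq : (Nat.sqrt x : ℝ) ≤ ε / 8 * (x / Real.log x) := by
    have h1 : (0 : ℝ) < (x : ℝ) ^ (1 / 2 : ℝ) := by positivity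
    have h2 : (x : ℝ) = (x : ℝ) ^ (1 / 2 : ℝ) * (x : ℝ) ^ (1 / 2 : ℝ) := by
      rw [← Real.rpow_add (by linarith)]; norm_num
    have h3 : (Nat.sqrt x : ℝ) ≤ (x : ℝ) ^ (1 / 2 : ℝ) := by
      rw [← Real.sqrt_eq_rpow]; exact Real.nat_sqrt_le_real_sqrt
    refine h3.trans ?_
    rw [div_le_iff₀ h1] at hsqrt
    rw [← mul_div_assoc, le_div_iff₀ hX]
    calc (x : ℝ) ^ (1 / 2 : ℝ) * Real.log x
        ≤ (x : ℝ) ^ (1 / 2 : ℝ) * (ε / 8 * (x : ℝ) ^ (1 / 2 : ℝ)) := by gcongr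
      _ = ε / 8 * ((x : ℝ) ^ (1 / 2 : ℝ) * (x : ℝ) ^ (1 / 2 : ℝ)) := by ring
      _ = _ := by rw [← h2]
  have hpi' : (x : ℝ) / Real.log x ≤ 2 * Nat.primeCounting x := by
    have h1 : (x : ℝ) / (2 * Real.log x) = x / Real.log x / 2 := by field_simp
    linarith
  have hpi0 : (0 : ℝ) < Nat.primeCounting x := by linarith
  rw [Real.dist_eq, sub_zero, abs_of_nonneg (by positivity), div_lt_iff₀ hpi0]
  calc _ ≤ ε / 8 * (x / Real.log x) + ε / 8 * (x / Real.log x) :=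
        hcard.trans (add_le_add hsq hbad)
    _ = ε / 4 * (x / Real.log x) := by ring
    _ ≤ ε / 4 * (2 * Nat.primeCounting x) := by gcongr
    _ = ε / 2 * Nat.primeCounting x := by ring
    _ < ε * Nat.primeCounting x := by gcongr; linarith
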